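/- Let $\alpha,\beta\in(1,2)$. Put $g_k^{(\alpha)}=(-1)^k\binom{\alpha}{k}$, $w_0^{(\alpha)}=\frac{\alpha}{2}g_0^{(\alpha)}$, $w_k^{(\alpha)}=\frac{\alpha}{2}g_k^{(\alpha)}+\frac{2-\alpha}{2}g_{k-1}^{(\alpha)}$ for $k\ge 1$, and let $S_{\alpha,n}$ be the $n\times n$ matrix with entries $-w^{(\alpha)}_{i-j+1}$ if $i-j\ge -1$ and $0$ otherwise. Let $$w_\alpha(\theta)=-\tfrac{2-\alpha(1-e^{-\mathbf i\theta})}{2}(1-e^{\mathbf i\theta})^\alpha,\qquad q_\alpha(\theta)=w_\alpha(\theta)+\overline{w_\alpha(\theta)},$$ and $\theta_{i,n}=\frac{i\pi}{n+1}$, $[\mathbb S_n]_{i,j}=\sqrt{\tfrac{2}{n+1}}\,\sin(i\theta_{j,n})$ for $i,j=1,\dots,n$. Let $\Omega=(L_1,R_1)\times(L_2,R_2)$, let $d_\pm,e_\pm$ be real functions of $(x,y,t)$ (the diffusion coefficients), and for $n_1,n_2\ge 1$, $N=n_1n_2$, $h_t>0$ let $h_x=\frac{R_1-L_1}{n_1+1}$,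 $h_y=\frac{R_2-L_2}{n_2+1}$, $x_i=L_1+ih_x$, $y_j=L_2+jh_y$, $t_m=mh_t$, $r=\frac{h_t}{2h_x^\alpha}$, $s=\frac{h_t}{2h_y^\beta}$. Let $D_\pm^{(m)}$, $E_\pm^{(m)}$ be the $N\times N$ diagonal matrices with the values $d_\pm(x_i,y_j,t_m)$, $e_\pm(x_i,y_j,t_m)$ on the diagonal ($i$ being the inner index). The coefficient matrix is $$\mathcal M^{(m)}_{(\alpha,\beta),N}=\tfrac1r\mathbb I_N+D_+^{(m)}(\mathbb I_{n_2}\otimes S_{\alpha,n_1})+D_-^{(m)}(\mathbb I_{n_2}\otimes S_{\alpha,n_1}^{\mathrm T})+\tfrac sr\left(E_+^{(m)}(S_{\beta,n_2}\otimes\mathbb I_{n_1})+E_-^{(m)}(S_{\beta,n_2}^{\mathrm T}\otimes\mathbb I_{n_1})\right).$$ For a constant $d>0$ the $\tau$ preconditioner (with equal constants $d=e$ in the two space directions) is $$\mathcal P_{\hat{\mathcal F}_{(\alpha,\beta)},N}=(\mathbb S_{n_2}\otimes\mathbb S_{n_1})\,\hat F_N\,(\mathbb S_{n_2}\otimes\mathbb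 S_{n_1}),$$ where $\hat F_N$ is the diagonal matrix of the samples $\hat{\mathcal F}_{(\alpha,\beta)}(\theta_{i,n_1},\theta_{j,n_2})$ of $\hat{\mathcal F}_{(\alpha,\beta)}(\theta_1,\theta_2)=\frac1r+d\,q_\alpha(\theta_1)+\frac sr d\,q_\beta(\theta_2)$. **Corollary.** Let $0<\mu\le\nu$. There are constants $c,C>0$, depending only on $\alpha,\beta,\mu,\nu$, such that the following holds. Let $\Omega$ and $T$ be arbitrary and suppose that $d_+=d_-=e_+=e_-$ on $\Omega\times[0,T]$, with all values there in $[\mu,\nu]$; that is, the diffusion coefficients are equal and lie between the positive constants $\mu$ and $\nu$. Then for all $n_1,n_2$, all $h_t>0$, all $m\ge 0$ with $t_m\le T$ and every constant $d\in[\mu,\nu]$, the matrix $\mathcal P_{\hat{\mathcal F}_{(\alpha,\beta)},N}$ is invertible and every (complex) eigenvalue $\lambda$ of $\mathcal P_{\hat{\mathcal F}_{(\alpha,\beta)},N}^{-1}\mathcal M^{(m)}_{(\alpha,\beta),N}$ satisfies $$c\le \operatorname{Re}\lambda\qquad\text{and}\qquad |\lambda|\le C.$$ In particular the spectrum is bounded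 by positive constants, $c\le|\lambda|\le C$, independently of $N$. -/

import Mathlib

open scoped Kronecker

noncomputable section

namespace FracDiff

/-- Alternating fractional binomial coefficients
`g_k = (-1)^k binom(α, k) = (-1)^k / k! * α (α - 1) ⋯ (α - k + 1)`. -/
def g (α : ℝ) (k : ℕ) : ℝ :=
  (-1) ^ k / (k.factorial : ℝ) * ∏ j ∈ Finset.range k, (α - (j : ℝ))

/-- Weights of the second-order shifted Grünwald formula:
`w_0 = (α/2) g_0`, `w_k = (α/2) g_k + ((2-α)/2) g_{k-1}` for `k ≥ 1`. -/
def w (α : ℝ) : ℕ → ℝ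
  | 0 => α / 2 * g α 0
  | k + 1 => α / 2 * g α (k + 1) + (2 - α) / 2 * g α k

/-- The `n × n` lower Hessenberg Toeplitz matrix with entries `-w_{i-j+1}` for `i - j ≥ -1`
and `0` otherwise. -/
def S (α : ℝ) (n : ℕ) : Matrix (Fin n) (Fin n) ℝ :=
  Matrix.of fun i j =>
    if (j : ℕ) ≤ (i : ℕ) + 1 then -w α ((i : ℕ) + 1 - (j : ℕ)) else 0

/-- The symbol `w_α(θ) = -((2 - α (1 - e^{-iθ})) / 2) (1 - e^{iθ})^α` of the matrices `S α n`. -/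
def wSymbol (α θ : ℝ) : ℂ :=
  -((2 - (α : ℂ) * (1 - Complex.exp (-(Complex.I * (θ : ℂ))))) / 2) *
    (1 - Complex.exp (Complex.I * (θ : ℂ))) ^ (α : ℂ)

/-- The real symbol `q_α(θ) = w_α(θ) + conj (w_α(θ))` of the matrices `S α n + (S α n)ᵀ`. -/
def qSymbol (α θ : ℝ) : ℝ :=
  (wSymbol α θ + (starRingEnd ℂ) (wSymbol α θ)).re

/-- The grid point `θ_{i+1} = (i+1) π / (n+1)`, with `i` running from `0` to `n - 1`. -/
def theta (n : ℕ) (i : Fin n) : ℝ :=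
  ((i : ℕ) + 1 : ℝ) * Real.pi / ((n : ℝ) + 1)

/-- The discrete sine transform matrix, `√(2/(n+1)) sin (i θ_j)` with one-based `i, j`. -/
def sineMatrix (n : ℕ) : Matrix (Fin n) (Fin n) ℝ :=
  Matrix.of fun i j =>
    Real.sqrt (2 / ((n : ℝ) + 1)) * Real.sin (((i : ℕ) + 1 : ℝ) * theta n j)

/-- Step size of the grid with `n` interior points on `(L, R)`. -/
def step (L R : ℝ) (n : ℕ) : ℝ := (R - L) / ((n : ℝ) + 1)

/-- Interior grid point `L + (i+1) h`, with `i` running from `0` to `n - 1`. -/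
def gridPoint (L R : ℝ) (n : ℕ) (i : Fin n) : ℝ :=
  L + ((i : ℕ) + 1 : ℝ) * step L R n

/-- `h_t / (2 h^γ)`; this is `r` for `γ = α`, `h = h_x` and `s` for `γ = β`, `h = h_y`. -/
def meshRatio (γ h ht : ℝ) : ℝ := ht / (2 * h ^ γ)

/-- The diagonal matrix of the values of a coefficient `a` on the spatial grid at time `t`.
The unknowns are indexed by `(j, i)`, `j` for `y` (outer index) and `i` for `x` (inner index). -/
def coeffDiag (a : ℝ → ℝ → ℝ → ℝ) (L₁ R₁ L₂ R₂ : ℝ) (n₁ n₂ : ℕ) (t : ℝ) :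
    Matrix (Fin n₂ × Fin n₁) (Fin n₂ × Fin n₁) ℝ :=
  Matrix.diagonal fun p => a (gridPoint L₁ R₁ n₁ p.2) (gridPoint L₂ R₂ n₂ p.1) t

/-- The coefficient matrix
`(1/r) I + D₊ (I ⊗ S_α) + D₋ (I ⊗ S_αᵀ) + (s/r) (E₊ (S_β ⊗ I) + E₋ (S_βᵀ ⊗ I))`
at time `t`, for the coefficients `dp = d₊`, `dm = d₋`, `ep = e₊`, `em = e₋`. -/
def coeffMatrix (α β L₁ R₁ L₂ R₂ ht : ℝ) (dp dm ep em : ℝ → ℝ → ℝ → ℝ) (n₁ n₂ : ℕ) (t : ℝ) :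
    Matrix (Fin n₂ × Fin n₁) (Fin n₂ × Fin n₁) ℝ :=
  let r := meshRatio α (step L₁ R₁ n₁) ht
  let s := meshRatio β (step L₂ R₂ n₂) ht
  (1 / r) • (1 : Matrix (Fin n₂ × Fin n₁) (Fin n₂ × Fin n₁) ℝ)
    + coeffDiag dp L₁ R₁ L₂ R₂ n₁ n₂ t * ((1 : Matrix (Fin n₂) (Fin n₂) ℝ) ⊗ₖ S α n₁)
    + coeffDiag dm L₁ R₁ L₂ R₂ n₁ n₂ t * ((1 : Matrix (Fin n₂) (Fin n₂) ℝ) ⊗ₖ (S α n₁).transpose)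
    + (s / r) •
      (coeffDiag ep L₁ R₁ L₂ R₂ n₁ n₂ t * (S β n₂ ⊗ₖ (1 : Matrix (Fin n₁) (Fin n₁) ℝ))
        + coeffDiag em L₁ R₁ L₂ R₂ n₁ n₂ t *
          ((S β n₂).transpose ⊗ₖ (1 : Matrix (Fin n₁) (Fin n₁) ℝ)))

/-- The diagonal matrix of samples of `1/r + d q_α(θ₁) + (s/r) e q_β(θ₂)`. -/
def FHat (α β L₁ R₁ L₂ R₂ ht d e : ℝ) (n₁ n₂ : ℕ) :
    Matrix (Fin n₂ × Fin n₁) (Fin n₂ × Fin n₁) ℝ :=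
  let r := meshRatio α (step L₁ R₁ n₁) ht
  let s := meshRatio β (step L₂ R₂ n₂) ht
  Matrix.diagonal fun p =>
    1 / r + d * qSymbol α (theta n₁ p.2) + s / r * e * qSymbol β (theta n₂ p.1)

/-- The `τ` preconditioner `(𝕊_{n₂} ⊗ 𝕊_{n₁}) F̂ (𝕊_{n₂} ⊗ 𝕊_{n₁})`. -/
def tauPreconditioner (α β L₁ R₁ L₂ R₂ ht d e : ℝ) (n₁ n₂ : ℕ) :
    Matrix (Fin n₂ × Fin n₁) (Fin n₂ × Fin n₁) ℝ :=
  (sineMatrix n₂ ⊗ₖ sineMatrix n₁) * FHat α β L₁ R₁ L₂ R₂ ht d e n₁ n₂ *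
    (sineMatrix n₂ ⊗ₖ sineMatrix n₁)

end FracDiff

end

noncomputable section

namespace FracDiff

open Finset

/-! ### Power sums -/

/-! With equal coefficients the two matrices are M = ε I + D H and P = ε I + d (H + E), where ε =
1/r, H is the (weighted) Kronecker sum of the matrices S + Sᵀ, and E that of the differences between
the τ matrices and S + Sᵀ. Suppose M v = λ P v, and that in some row i with v_i ≠ 0 one has (H v)_i
= X v_i and (E v)_i = Y v_i with Re X > 0 and |Y| ≤ ρ Re X, ρ < 1. Then ε + D_i X = λ (ε + d X + d
Y), which bounds λ in terms of ρ, μ, ν alone (`le_re_quotient`, `norm_quotient_le`). Only one value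
D_i enters, so no regularity of the coefficients is needed.

Such a row comes from a weighted maximum principle (`DominatedBy.exists_ratio`): H has nonpositive
off-diagonal entries, so a positive φ with H φ > 0 and |E| φ ≤ ρ H φ suffices. This property passes
to Kronecker sums, so a one-dimensional φ is needed, with ρ < 1 independent of n
(`exists_dominatedBy`).

In one dimension A = S + Sᵀ is the operator L f(i) = ∑ a_k (2 f(i) - f(i+k) - f(i-k)), a_k of order
k^{-(1+α)}, applied to extensions by zero from 1, …, n; the τ matrix is L applied to odd
2(n+1)-periodic extensions. For f ≥ 0 even and N-periodic, N = n + 1, this yields A f = L f + e and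
|E| f ≤ e, with e the `exitSum`. If e ≤ K L f, then ρ = K/(1+K) works. The `barrier` f solves L f =
i^{-(1+s)} + (N-i)^{-(1+s)} by Fourier analysis on ℤ/N, with s = (α-1)/2. It grows at most like m^s,
so e is at most of order ∑_{k ≥ i} k^{-(1+α)+s}, i.e. i^{-(1+s)}, plus the mirror term. -/

theorem rpow_neg_one_sub_le_telescope {p : ℝ} (hp : 0 < p) {k : ℕ} (hk : 1 ≤ k) :
    (k : ℝ) ^ (-(1 + p)) ≤ (p + 2) / p * ((k : ℝ) ^ (-p) - ((k + 1 : ℕ) : ℝ) ^ (-p)) := by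
  have hk0 : (0 : ℝ) < k := by exact_mod_cast hk
  have hk1 : (1 : ℝ) ≤ k := by exact_mod_cast hk
  set t : ℝ := 1 / k with ht
  have ht0 : 0 < t := by positivity
  have ht1 : t ≤ 1 := by rw [ht, div_le_one hk0]; exact hk1
  have e1 : ((k + 1 : ℕ) : ℝ) = k * (1 + t) := by push_cast; rw [ht]; field_simp
  have e2 : (k : ℝ) ^ (-(1 + p)) = (k : ℝ) ^ (-p) * t := by
    rw [show -(1 + p) = -p - 1 by ring, Real.rpow_sub_one hk0.ne', ht]; ring
  rw [e1, Real.mul_rpow hk0.le (by positivity), e2]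
  -- For 0 < t ≤ 1, log (1 + t) ≥ t / (1 + t) ≥ t / 2, so (1 + t)^p ≥ exp (p t / 2).
  have hpow : (1 + t) ^ (-p) ≤ 1 / (1 + p * t / 2) := by
    rw [Real.rpow_neg (by positivity), ← one_div]
    apply one_div_le_one_div_of_le (by positivity)
    have hlog : t / 2 ≤ Real.log (1 + t) := by
      have := Real.one_sub_inv_le_log_of_pos (show 0 < 1 + t by positivity)
      refine le_trans ?_ this
      rw [show 1 - (1 + t)⁻¹ = t / (1 + t) by field_simp; ring]
      gcongr
      linarith
    calc 1 + p * t / 2 ≤ Real.exp (p * t / 2) := by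
            have := Real.add_one_le_exp (p * t / 2); linarith
      _ ≤ Real.exp (Real.log (1 + t) * p) := by
            apply Real.exp_le_exp.2; nlinarith
      _ = (1 + t) ^ p := by rw [Real.rpow_def_of_pos (by positivity)]
  have hgap : t ≤ (p + 2) / p * (1 - (1 + t) ^ (-p)) := by
    have h1 : p * t / (p + 2) ≤ 1 - 1 / (1 + p * t / 2) := by
      rw [show 1 - 1 / (1 + p * t / 2) = p * t / (p * t + 2) by field_simp; ring]
      gcongr
      nlinarith
    have h2 : p * t / (p + 2) ≤ 1 - (1 + t) ^ (-p) := by linarith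
    calc t = (p + 2) / p * (p * t / (p + 2)) := by field_simp
      _ ≤ _ := by gcongr
  calc (k : ℝ) ^ (-p) * t ≤ (k : ℝ) ^ (-p) * ((p + 2) / p * (1 - (1 + t) ^ (-p))) := by gcongr
    _ = _ := by ring

theorem sum_Ico_rpow_le {p : ℝ} (hp : 0 < p) {m : ℕ} (hm : 1 ≤ m) (M : ℕ) :
    ∑ k ∈ Ico m M, (k : ℝ) ^ (-(1 + p)) ≤ (p + 2) / p * (m : ℝ) ^ (-p) := by
  rcases le_total M m with h | h
  · rw [Ico_eq_empty_of_le h, sum_empty]; positivity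
  · have key : ∑ k ∈ Ico m M, (k : ℝ) ^ (-(1 + p)) ≤
        (p + 2) / p * ((m : ℝ) ^ (-p) - (M : ℝ) ^ (-p)) := by
      induction M, h using Nat.le_induction with
      | base => simp
      | succ M hM ih =>
        rw [sum_Ico_succ_top hM]
        have := rpow_neg_one_sub_le_telescope hp (hm.trans hM)
        linarith
    refine key.trans ?_
    gcongr
    have : (0 : ℝ) ≤ (M : ℝ) ^ (-p) := by positivity
    linarith

/-- Split at l = X. Below, s ≤ 1 makes each term at most X^{-(1+s)}, and there are fewer than X
terms; above, the tail bound applies. It serves for sums over jumps (X = 1/ξ) and over frequencies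
(X = N/(2πm)). -/
theorem sum_min_mul_rpow_le {s : ℝ} (hs : 0 < s) (hs1 : s ≤ 1) {X : ℝ} (hX : 0 < X) (M : ℕ) :
    ∑ l ∈ Ico 1 M, min 1 (((l : ℝ) / X) ^ 2) * (l : ℝ) ^ (-(1 + s)) ≤
      (1 + (s + 2) / s) * X ^ (-s) := by
  set m := ⌈X⌉₊ with hm
  have hm1 : 1 ≤ m := Nat.one_le_ceil_iff.2 hX
  have hXm : X ≤ m := Nat.le_ceil X
  have hmX : (m : ℝ) < X + 1 := Nat.ceil_lt_add_one hX.le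
  have small : ∑ l ∈ Ico 1 m, min 1 (((l : ℝ) / X) ^ 2) * (l : ℝ) ^ (-(1 + s)) ≤ X ^ (-s) := by
    have hterm : ∀ l ∈ Ico 1 m, min 1 (((l : ℝ) / X) ^ 2) * (l : ℝ) ^ (-(1 + s)) ≤
        X ^ (-(1 + s)) := by
      intro l hl
      rw [mem_Ico] at hl
      have hl0 : (0 : ℝ) < l := by exact_mod_cast hl.1
      have hlX : (l : ℝ) < X := Nat.lt_ceil.1 hl.2
      have e : ((l : ℝ) / X) ^ 2 * (l : ℝ) ^ (-(1 + s)) = (l : ℝ) ^ (1 - s) / X ^ (2 : ℝ) := by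
        rw [div_pow, show (1 : ℝ) - s = 2 + -(1 + s) by ring, Real.rpow_add hl0,
          Real.rpow_two, Real.rpow_two]
        ring
      calc min 1 (((l : ℝ) / X) ^ 2) * (l : ℝ) ^ (-(1 + s))
          ≤ ((l : ℝ) / X) ^ 2 * (l : ℝ) ^ (-(1 + s)) := by gcongr; exact min_le_right _ _
        _ = (l : ℝ) ^ (1 - s) / X ^ (2 : ℝ) := e
        _ ≤ X ^ (1 - s) / X ^ (2 : ℝ) := by
            gcongr
        _ = X ^ (-(1 + s)) := by rw [← Real.rpow_sub hX]; congr 1; ring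
    refine (sum_le_sum hterm).trans ?_
    rw [sum_const, Nat.card_Ico, nsmul_eq_mul, Nat.cast_sub hm1]
    calc ((m : ℝ) - (1 : ℕ)) * X ^ (-(1 + s)) ≤ X * X ^ (-(1 + s)) := by
          gcongr; push_cast; linarith
      _ = X ^ (-s) := by
          rw [show -s = 1 + -(1 + s) by ring, Real.rpow_add hX, Real.rpow_one]
  have large : ∑ l ∈ Ico m M, min 1 (((l : ℝ) / X) ^ 2) * (l : ℝ) ^ (-(1 + s)) ≤
      (s + 2) / s * X ^ (-s) := by
    calc ∑ l ∈ Ico m M, min 1 (((l : ℝ) / X) ^ 2) * (l : ℝ) ^ (-(1 + s))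
        ≤ ∑ l ∈ Ico m M, (l : ℝ) ^ (-(1 + s)) := by
          apply sum_le_sum
          intro l _
          have : (0 : ℝ) ≤ (l : ℝ) ^ (-(1 + s)) := by positivity
          calc _ ≤ 1 * (l : ℝ) ^ (-(1 + s)) := by gcongr; exact min_le_left _ _
            _ = _ := one_mul _
      _ ≤ (s + 2) / s * (m : ℝ) ^ (-s) := sum_Ico_rpow_le hs hm1 M
      _ ≤ (s + 2) / s * X ^ (-s) := by
          gcongr 1
          exact Real.rpow_le_rpow_of_nonpos hX hXm (by linarith)
  have hsub : Ico 1 M ⊆ Ico 1 m ∪ Ico m M := by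
    intro l; simp only [mem_union, mem_Ico]; omega
  calc _ ≤ ∑ l ∈ Ico 1 m ∪ Ico m M, min 1 (((l : ℝ) / X) ^ 2) * (l : ℝ) ^ (-(1 + s)) :=
        sum_le_sum_of_subset_of_nonneg hsub fun l _ _ => by positivity
    _ = _ := sum_union (Ico_disjoint_Ico_consecutive 1 m M)
    _ ≤ (1 + (s + 2) / s) * X ^ (-s) := by linarith

theorem summable_ite_rpow_and_tsum_le {p : ℝ} (hp : 0 < p) {m : ℕ} (hm : 1 ≤ m) :
    Summable (fun k : ℕ => if m ≤ k then (k : ℝ) ^ (-(1 + p)) else 0) ∧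
      ∑' k : ℕ, (if m ≤ k then (k : ℝ) ^ (-(1 + p)) else 0) ≤ (p + 2) / p * (m : ℝ) ^ (-p) := by
  have hb : ∀ M, ∑ k ∈ range M, (if m ≤ k then (k : ℝ) ^ (-(1 + p)) else 0) ≤
      (p + 2) / p * (m : ℝ) ^ (-p) := by
    intro M
    rw [← sum_filter]
    have : (range M).filter (fun k => m ≤ k) = Ico m M := by
      ext k; simp [and_comm]
    rw [this]
    exact sum_Ico_rpow_le hp hm M
  have h0 : ∀ k : ℕ, 0 ≤ (if m ≤ k then (k : ℝ) ^ (-(1 + p)) else 0) := by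
    intro k; split_ifs <;> positivity
  exact ⟨summable_of_sum_range_le h0 hb, Real.tsum_le_of_sum_range_le h0 hb⟩

/-! ### Discrete orthogonality -/

theorem sum_range_cos {M : ℕ} (hM : 0 < M) (m : ℤ) :
    ∑ l ∈ range M, Real.cos (m * (2 * Real.pi * l / M)) = if (M : ℤ) ∣ m then (M : ℝ) else 0 := by
  have hM' : (M : ℂ) ≠ 0 := by exact_mod_cast hM.ne'
  have hMr : (M : ℝ) ≠ 0 := by exact_mod_cast hM.ne'
  set ζ : ℂ := Complex.exp (2 * Real.pi * Complex.I / M) with hζ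
  have hprim : IsPrimitiveRoot ζ M := Complex.isPrimitiveRoot_exp M hM.ne'
  have hterm : ∀ l : ℕ, Real.cos (m * (2 * Real.pi * l / M)) = (((ζ ^ m) ^ l : ℂ)).re := by
    intro l
    rw [hζ, ← Complex.exp_int_mul, ← Complex.exp_nat_mul,
      show ((l : ℂ) * (m * (2 * Real.pi * Complex.I / M))) =
        ((m * (2 * Real.pi * l / M) : ℝ) : ℂ) * Complex.I by push_cast; ring,
      Complex.exp_ofReal_mul_I_re]
  simp_rw [hterm]
  rw [← Complex.re_sum]
  split_ifs with h
  · rw [(hprim.zpow_eq_one_iff_dvd m).2 h]; simp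
  · have hne : ζ ^ m ≠ 1 := fun h' => h ((hprim.zpow_eq_one_iff_dvd m).1 h')
    rw [geom_sum_eq hne]
    have : (ζ ^ m) ^ M = 1 := by
      rw [← zpow_natCast, ← zpow_mul, mul_comm, zpow_mul, zpow_natCast, hprim.pow_eq_one, one_zpow]
    rw [this]; simp

/-! ### Cosine symbols and the periodic barrier function -/

/-- The symbol `2 ∑ a_k (1 - cos kξ)` of the symmetric Lévy-type operator with jump weights `a`. -/
def cosSymbol (a : ℕ → ℝ) (ξ : ℝ) : ℝ := 2 * ∑' k : ℕ, a k * (1 - Real.cos (k * ξ))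

/-- The symbol `2 ∑_{1 ≤ k < N} k^{-(1+s)} (1 - cos kξ)`. -/
def powerSymbol (s : ℝ) (N : ℕ) (ξ : ℝ) : ℝ :=
  2 * ∑ k ∈ Ico 1 N, (k : ℝ) ^ (-(1 + s)) * (1 - Real.cos (k * ξ))

/-- The Fourier frequency `2πl/N`. -/
def freq (N l : ℕ) : ℝ := 2 * Real.pi * l / N

/-- An even `N`-periodic function vanishing at `0`, which the operator with jump weights `a` maps to
`i ↦ i^{-(1+s)} + (N-i)^{-(1+s)}` away from the multiples of `N`. -/
def barrier (a : ℕ → ℝ) (s : ℝ) (N : ℕ) (m : ℤ) : ℝ :=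
  1 / N * ∑ l ∈ range N,
    (1 - Real.cos (m * freq N l)) * (powerSymbol s N (freq N l) / cosSymbol a (freq N l))

/-! ### Size of the symbols and growth of the barrier. -/

theorem one_sub_cos_nonneg (x : ℝ) : 0 ≤ 1 - Real.cos x := by
  linarith [Real.cos_le_one x]

theorem one_sub_cos_le (x : ℝ) : 1 - Real.cos x ≤ 2 * min 1 (x ^ 2) := by
  rcases le_total 1 (x ^ 2) with h | h
  · rw [min_eq_left h]; linarith [Real.neg_one_le_cos x]
  · rw [min_eq_right h]; nlinarith [Real.one_sub_sq_div_two_le_cos (x := x), sq_nonneg x]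

theorem summable_mul_one_sub_cos {a : ℕ → ℝ} (ha : ∀ k, 0 ≤ a k) (hs : Summable a) (ξ : ℝ) :
    Summable fun k : ℕ => a k * (1 - Real.cos (k * ξ)) := by
  refine Summable.of_nonneg_of_le (fun k => mul_nonneg (ha k) (one_sub_cos_nonneg _))
    (fun k => ?_) (hs.mul_right 2)
  exact mul_le_mul_of_nonneg_left (by linarith [Real.neg_one_le_cos ((k : ℝ) * ξ)]) (ha k)

theorem powerSymbol_nonneg (s : ℝ) (N : ℕ) (ξ : ℝ) : 0 ≤ powerSymbol s N ξ := by
  unfold powerSymbol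
  have : ∀ k ∈ Ico 1 N, 0 ≤ (k : ℝ) ^ (-(1 + s)) * (1 - Real.cos (k * ξ)) := fun k _ =>
    mul_nonneg (by positivity) (one_sub_cos_nonneg _)
  have := sum_nonneg this
  positivity

theorem cosSymbol_nonneg {a : ℕ → ℝ} (ha : ∀ k, 0 ≤ a k) (ξ : ℝ) : 0 ≤ cosSymbol a ξ := by
  unfold cosSymbol
  have : 0 ≤ ∑' k : ℕ, a k * (1 - Real.cos (k * ξ)) :=
    tsum_nonneg fun k => mul_nonneg (ha k) (one_sub_cos_nonneg _)
  positivity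

/-- Keep only the K = ⌊π/ξ⌋ terms with kξ ≤ π, where 1 - cos kξ ≥ (2/π²)(kξ)². Each is at least a
constant times ξ² K^{1-α}, and K ≥ 1/ξ turns ξ² K^{2-α} into ξ^α. -/
theorem cosSymbol_ge {a : ℕ → ℝ} (ha : ∀ k, 0 ≤ a k) (hs : Summable a) {α c : ℝ} (hα : 1 < α)
    (hα2 : α < 2) (hc : 0 < c) (hlow : ∀ k : ℕ, 1 ≤ k → c * (k : ℝ) ^ (-(1 + α)) ≤ a k) {ξ : ℝ}
    (hξ : 0 < ξ) (hξπ : ξ ≤ Real.pi) :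
    4 * c / Real.pi ^ 2 * ξ ^ α ≤ cosSymbol a ξ := by
  have hπ := Real.pi_pos
  set K := ⌊Real.pi / ξ⌋₊ with hK
  have hK1 : 1 ≤ K := by
    rw [hK, Nat.one_le_floor_iff, le_div_iff₀ hξ]; linarith
  have hK1' : (1 : ℝ) ≤ K := by exact_mod_cast hK1
  have hKle : (K : ℝ) ≤ Real.pi / ξ := Nat.floor_le (by positivity)
  have hKge : Real.pi / ξ < K + 1 := Nat.lt_floor_add_one _
  have hKξ : 1 / ξ ≤ K := by
    have h2 : Real.pi / ξ ≤ 2 * K := by linarith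
    have h3 : 2 / ξ ≤ Real.pi / ξ := by gcongr; exact Real.two_le_pi
    have h4 : 2 / ξ = 2 * (1 / ξ) := by ring
    linarith
  have hterm : ∀ k ∈ Ico 1 (K + 1), 2 * c / Real.pi ^ 2 * ξ ^ 2 * (K : ℝ) ^ (1 - α) ≤
      a k * (1 - Real.cos (k * ξ)) := by
    intro k hk
    rw [mem_Ico] at hk
    have hk0 : (0 : ℝ) < k := by exact_mod_cast hk.1
    have hkK : (k : ℝ) ≤ K := by exact_mod_cast Nat.lt_succ_iff.1 hk.2
    have hkπ : (k : ℝ) * ξ ≤ Real.pi := by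
      have := hkK.trans hKle
      rwa [le_div_iff₀ hξ] at this
    have hcos := Real.cos_le_one_sub_mul_cos_sq (x := k * ξ)
      (by rw [abs_of_pos (by positivity)]; exact hkπ)
    have e : (k : ℝ) ^ (-(1 + α)) * (k : ℝ) ^ 2 = (k : ℝ) ^ (1 - α) := by
      rw [← Real.rpow_two, ← Real.rpow_add hk0]; congr 1; ring
    calc 2 * c / Real.pi ^ 2 * ξ ^ 2 * (K : ℝ) ^ (1 - α)
        ≤ 2 * c / Real.pi ^ 2 * ξ ^ 2 * (k : ℝ) ^ (1 - α) := by
          gcongr 1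
          exact Real.rpow_le_rpow_of_nonpos hk0 hkK (by linarith)
      _ = (c * (k : ℝ) ^ (-(1 + α))) * (2 / Real.pi ^ 2 * (k * ξ) ^ 2) := by rw [← e]; ring
      _ ≤ a k * (1 - Real.cos (k * ξ)) := by
          gcongr
          · exact ha k
          · exact hlow k hk.1
          · linarith
  have hsum := (sum_le_sum hterm).trans
    ((summable_mul_one_sub_cos ha hs ξ).sum_le_tsum _ fun k _ =>
      mul_nonneg (ha k) (one_sub_cos_nonneg _))
  rw [sum_const, Nat.card_Ico, nsmul_eq_mul, Nat.add_sub_cancel] at hsum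
  unfold cosSymbol
  have e1 : (K : ℝ) * (K : ℝ) ^ (1 - α) = (K : ℝ) ^ (2 - α) := by
    rw [show 2 - α = 1 + (1 - α) by ring, Real.rpow_add (by linarith), Real.rpow_one]
  have e2 : ξ ^ α ≤ ξ ^ 2 * (K : ℝ) ^ (2 - α) := by
    calc ξ ^ α = ξ ^ 2 * (1 / ξ) ^ (2 - α) := by
          rw [one_div, Real.inv_rpow hξ.le, ← Real.rpow_neg hξ.le, ← Real.rpow_two,
            ← Real.rpow_add hξ]
          congr 1; ring
      _ ≤ ξ ^ 2 * (K : ℝ) ^ (2 - α) := by gcongr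
  calc 4 * c / Real.pi ^ 2 * ξ ^ α ≤ 4 * c / Real.pi ^ 2 * (ξ ^ 2 * (K : ℝ) ^ (2 - α)) := by
        gcongr
    _ = 2 * (K * (2 * c / Real.pi ^ 2 * ξ ^ 2 * (K : ℝ) ^ (1 - α))) := by rw [← e1]; ring
    _ ≤ _ := by gcongr

theorem powerSymbol_le {s : ℝ} (hs : 0 < s) (hs1 : s ≤ 1) (N : ℕ) {ξ : ℝ} (hξ : 0 < ξ) :
    powerSymbol s N ξ ≤ 4 * (1 + (s + 2) / s) * ξ ^ s := by
  unfold powerSymbol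
  have h1 : ∑ k ∈ Ico 1 N, (k : ℝ) ^ (-(1 + s)) * (1 - Real.cos (k * ξ)) ≤
      2 * ∑ k ∈ Ico 1 N, min 1 (((k : ℝ) / (1 / ξ)) ^ 2) * (k : ℝ) ^ (-(1 + s)) := by
    rw [mul_sum]
    apply sum_le_sum
    intro k _
    have := one_sub_cos_le (k * ξ)
    rw [show (k : ℝ) / (1 / ξ) = k * ξ by field_simp]
    have h0 : (0 : ℝ) ≤ (k : ℝ) ^ (-(1 + s)) := by positivity
    nlinarith
  have h2 := sum_min_mul_rpow_le hs hs1 (X := 1 / ξ) (by positivity) N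
  have e : (1 / ξ) ^ (-s) = ξ ^ s := by
    rw [one_div, Real.inv_rpow hξ.le, Real.rpow_neg hξ.le, inv_inv]
  rw [e] at h2
  linarith

/-- The reflection l ↦ N - l folds the nonzero frequencies into (0, π], the range of `cosSymbol_ge`.
-/
theorem cos_mul_freq_sub {N l : ℕ} (hl : l ≤ N) (hN : 0 < N) (m : ℤ) :
    Real.cos (m * freq N (N - l)) = Real.cos (m * freq N l) := by
  have hN' : (N : ℝ) ≠ 0 := by exact_mod_cast hN.ne'
  have : (m : ℝ) * freq N (N - l) = m * (2 * Real.pi) - m * freq N l := by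
    unfold freq; rw [Nat.cast_sub hl]; field_simp
  rw [this, Real.cos_int_mul_two_pi_sub]

theorem cosSymbol_freq_sub (a : ℕ → ℝ) {N l : ℕ} (hl : l ≤ N) (hN : 0 < N) :
    cosSymbol a (freq N (N - l)) = cosSymbol a (freq N l) := by
  unfold cosSymbol
  congr 2; ext k
  have := cos_mul_freq_sub hl hN k
  push_cast at this
  rw [this]

theorem powerSymbol_freq_sub (s : ℝ) {N l : ℕ} (hl : l ≤ N) (hN : 0 < N) :
    powerSymbol s N (freq N (N - l)) = powerSymbol s N (freq N l) := by
  unfold powerSymbol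
  congr 1
  refine sum_congr rfl fun k _ => ?_
  have := cos_mul_freq_sub hl hN k
  push_cast at this
  rw [this]

theorem cos_mul_freq_periodic {N : ℕ} (hN : 0 < N) (m j : ℤ) (l : ℕ) :
    Real.cos ((m + j * N : ℤ) * freq N l) = Real.cos (m * freq N l) := by
  have hN' : (N : ℝ) ≠ 0 := by exact_mod_cast hN.ne'
  have : ((m + j * N : ℤ) : ℝ) * freq N l = m * freq N l + (j * l : ℤ) * (2 * Real.pi) := by
    unfold freq; push_cast; field_simp
  rw [this, Real.cos_add_int_mul_two_pi]

theorem barrier_periodic (a : ℕ → ℝ) (s : ℝ) {N : ℕ} (hN : 0 < N) (m j : ℤ) :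
    barrier a s N (m + j * N) = barrier a s N m := by
  unfold barrier
  simp_rw [cos_mul_freq_periodic hN]

theorem barrier_neg (a : ℕ → ℝ) (s : ℝ) (N : ℕ) (m : ℤ) :
    barrier a s N (-m) = barrier a s N m := by
  unfold barrier
  simp

theorem barrier_zero (a : ℕ → ℝ) (s : ℝ) (N : ℕ) : barrier a s N 0 = 0 := by
  simp [barrier]

theorem barrier_nonneg {a : ℕ → ℝ} (ha : ∀ k, 0 ≤ a k) (s : ℝ) (N : ℕ) (m : ℤ) :
    0 ≤ barrier a s N m := by
  unfold barrier
  refine mul_nonneg (by positivity) (sum_nonneg fun l _ => mul_nonneg (one_sub_cos_nonneg _) ?_)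
  exact div_nonneg (powerSymbol_nonneg _ _ _) (cosSymbol_nonneg ha _)

theorem freq_pos {N l : ℕ} (hl : 1 ≤ l) (hN : 0 < N) : 0 < freq N l := by
  have h1 : (0 : ℝ) < l := by exact_mod_cast hl
  have h2 : (0 : ℝ) < N := by exact_mod_cast hN
  unfold freq
  have := Real.pi_pos
  positivity

theorem freq_le_pi {N l : ℕ} (hl : 2 * l ≤ N) (hN : 0 < N) : freq N l ≤ Real.pi := by
  have h1 : (2 : ℝ) * l ≤ N := by exact_mod_cast hl
  have h2 : (0 : ℝ) < N := by exact_mod_cast hN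
  unfold freq
  rw [div_le_iff₀ h2]
  nlinarith [Real.pi_pos]

/-- Since α = 1 + 2s, the quotient of the symbols is at most of order ξ^{s-α} = ξ^{-(1+s)}. Against
1 - cos mξ ≤ 2 min(1, (mξ)²) the frequency sum is that of `sum_min_mul_rpow_le`; the powers of N
cancel and m^s remains. -/
theorem barrier_le {a : ℕ → ℝ} (ha : ∀ k, 0 ≤ a k) (hsum : Summable a) {α c s : ℝ} (hα : 1 < α)
    (hα2 : α < 2) (hc : 0 < c) (hlow : ∀ k : ℕ, 1 ≤ k → c * (k : ℝ) ^ (-(1 + α)) ≤ a k)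
    (hs : s = (α - 1) / 2) :
    ∃ C : ℝ, 0 ≤ C ∧ ∀ (N m : ℕ), 0 < N → barrier a s N m ≤ C * (m : ℝ) ^ s := by
  have hs0 : 0 < s := by linarith
  have hs1 : s ≤ 1 := by linarith
  have hπ := Real.pi_pos
  set B : ℝ := 4 * (1 + (s + 2) / s) / (4 * c / Real.pi ^ 2) with hB
  have hB0 : 0 ≤ B := by positivity
  refine ⟨2 * (2 * B * (2 * Real.pi) ^ (-(1 + s)) * ((1 + (s + 2) / s) * (2 * Real.pi) ^ s)),
    by positivity, fun N m hN => ?_⟩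
  have hNr : (0 : ℝ) < N := by exact_mod_cast hN
  rcases Nat.eq_zero_or_pos m with rfl | hm
  · rw [Nat.cast_zero, barrier_zero]; positivity
  have hmr : (0 : ℝ) < m := by exact_mod_cast hm
  set X : ℝ := N / (2 * Real.pi * m) with hX
  have hX0 : 0 < X := by positivity
  set u : ℕ → ℝ := fun l => 2 * B * (2 * Real.pi / N) ^ (-(1 + s)) *
    (min 1 (((l : ℝ) / X) ^ 2) * (l : ℝ) ^ (-(1 + s))) with hu
  set F : ℕ → ℝ := fun l => (1 - Real.cos ((m : ℤ) * freq N l)) *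
    (powerSymbol s N (freq N l) / cosSymbol a (freq N l)) with hF
  have hu0 : ∀ l, 0 ≤ u l := fun l => by simp only [hu]; positivity
  have hhalf : ∀ l, 1 ≤ l → 2 * l ≤ N → F l ≤ u l := by
    intro l hl hlN
    have hl0 : (0 : ℝ) < l := by exact_mod_cast hl
    have hξ := freq_pos hl hN
    have hq := cosSymbol_ge ha hsum hα hα2 hc hlow hξ (freq_le_pi hlN hN)
    have hp := powerSymbol_le hs0 hs1 N hξ
    have hratio : powerSymbol s N (freq N l) / cosSymbol a (freq N l) ≤
        B * freq N l ^ (-(1 + s)) := by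
      calc _ ≤ (4 * (1 + (s + 2) / s) * freq N l ^ s) / (4 * c / Real.pi ^ 2 * freq N l ^ α) := by
            gcongr
        _ = B * (freq N l ^ s / freq N l ^ α) := by rw [hB, mul_div_mul_comm]
        _ = B * freq N l ^ (-(1 + s)) := by
            rw [← Real.rpow_sub hξ, show s - α = -(1 + s) by linarith]
    have hcos := one_sub_cos_le ((m : ℤ) * freq N l)
    have e1 : ((m : ℤ) : ℝ) * freq N l = l / X := by
      rw [hX]; unfold freq; push_cast; field_simp
    have e2 : freq N l ^ (-(1 + s)) = (2 * Real.pi / N) ^ (-(1 + s)) * (l : ℝ) ^ (-(1 + s)) := by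
      rw [← Real.mul_rpow (by positivity) hl0.le]; unfold freq; congr 1; ring
    calc F l ≤ (2 * min 1 (((m : ℤ) * freq N l) ^ 2)) * (B * freq N l ^ (-(1 + s))) := by
          simp only [hF]
          gcongr
          exact div_nonneg (powerSymbol_nonneg _ _ _) (cosSymbol_nonneg ha _)
      _ = u l := by rw [e1, e2]; simp only [hu]; ring
  -- Adding the reflected majorant covers l > N/2 without splitting the sum, at the cost of a factor
  -- 2.
  have hall : ∀ l ∈ Ico 1 N, F l ≤ u l + u (N - l) := by
    intro l hl
    rw [mem_Ico] at hl
    rcases le_total (2 * l) N with h | h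
    · linarith [hhalf l hl.1 h, hu0 (N - l)]
    · have := hhalf (N - l) (by omega) (by omega)
      have e : F (N - l) = F l := by
        simp only [hF]
        rw [cos_mul_freq_sub hl.2.le hN, cosSymbol_freq_sub a hl.2.le hN,
          powerSymbol_freq_sub s hl.2.le hN]
      rw [e] at this
      linarith [hu0 l]
  have hreflect : ∑ l ∈ Ico 1 N, u (N - l) = ∑ l ∈ Ico 1 N, u l := by
    have := Finset.sum_Ico_reflect u 1 (m := N) (n := N) (by omega)
    rw [this]
    congr 2; omega
  have hF0 : F 0 = 0 := by simp [hF, freq]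
  have hrange : ∑ l ∈ range N, F l = ∑ l ∈ Ico 1 N, F l := by
    rw [range_eq_Ico, sum_eq_sum_Ico_succ_bot hN, hF0, zero_add]
  have htot : ∑ l ∈ Ico 1 N, u l ≤ 2 * B * (2 * Real.pi / N) ^ (-(1 + s)) *
      ((1 + (s + 2) / s) * X ^ (-s)) := by
    simp only [hu]
    rw [← mul_sum]
    gcongr
    exact sum_min_mul_rpow_le hs0 hs1 hX0 N
  have hscale : (2 * Real.pi / N) ^ (-(1 + s)) * X ^ (-s) =
      N * ((2 * Real.pi) ^ (-(1 + s)) * ((2 * Real.pi) ^ s * (m : ℝ) ^ s)) := by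
    rw [hX, Real.div_rpow (by positivity) hNr.le, Real.div_rpow hNr.le (by positivity),
      Real.rpow_neg (x := 2 * Real.pi * m) (by positivity),
      Real.mul_rpow (x := 2 * Real.pi) (by positivity) hmr.le,
      div_inv_eq_mul, Real.rpow_neg hNr.le (1 + s), div_inv_eq_mul]
    have : (N : ℝ) ^ (1 + s) * (N : ℝ) ^ (-s) = N := by
      rw [← Real.rpow_add hNr]; simp
    calc _ = (2 * Real.pi) ^ (-(1 + s)) * ((2 * Real.pi) ^ s * (m : ℝ) ^ s) *
          ((N : ℝ) ^ (1 + s) * (N : ℝ) ^ (-s)) := by ring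
      _ = _ := by rw [this]; ring
  have hmain : ∑ l ∈ range N, F l ≤ 2 * (2 * B * (2 * Real.pi / N) ^ (-(1 + s)) *
      ((1 + (s + 2) / s) * X ^ (-s))) := by
    rw [hrange]
    have := sum_le_sum hall
    rw [sum_add_distrib, hreflect] at this
    linarith
  calc barrier a s N m = 1 / N * ∑ l ∈ range N, F l := rfl
    _ ≤ 1 / N * (2 * (2 * B * (2 * Real.pi / N) ^ (-(1 + s)) *
      ((1 + (s + 2) / s) * X ^ (-s)))) := by gcongr
    _ = 1 / N * (2 * (2 * B * (1 + (s + 2) / s) *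
      ((2 * Real.pi / N) ^ (-(1 + s)) * X ^ (-s)))) := by ring
    _ = _ := by rw [hscale]; field_simp

theorem cosSymbol_freq_pos {a : ℕ → ℝ} (ha : ∀ k, 0 ≤ a k) (hsum : Summable a) {α c : ℝ}
    (hα : 1 < α) (hα2 : α < 2) (hc : 0 < c)
    (hlow : ∀ k : ℕ, 1 ≤ k → c * (k : ℝ) ^ (-(1 + α)) ≤ a k) {N l : ℕ} (hl : l ∈ Ico 1 N) :
    0 < cosSymbol a (freq N l) := by
  rw [mem_Ico] at hl
  have hN : 0 < N := by omega
  have hπ := Real.pi_pos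
  have half : ∀ j, 1 ≤ j → 2 * j ≤ N → 0 < cosSymbol a (freq N j) := by
    intro j hj hjN
    have hξ := freq_pos hj hN
    refine lt_of_lt_of_le ?_ (cosSymbol_ge ha hsum hα hα2 hc hlow hξ (freq_le_pi hjN hN))
    positivity
  rcases le_total (2 * l) N with h | h
  · exact half l hl.1 h
  · rw [← cosSymbol_freq_sub a hl.2.le hN]
    exact half (N - l) (by omega) (by omega)

/-! ### The equation satisfied by the barrier. -/

theorem sum_cos_mul_freq {N : ℕ} (hN : 0 < N) (m : ℤ) :
    ∑ l ∈ range N, Real.cos (m * freq N l) = if (N : ℤ) ∣ m then (N : ℝ) else 0 :=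
  sum_range_cos hN m

/-- Fourier inversion on ℤ/N: orthogonality retains only k = i and k = N - i, and the constant part
of the symbol drops out because N does not divide i. -/
theorem sum_cos_mul_powerSymbol (s : ℝ) {N i : ℕ} (hi : 1 ≤ i) (hiN : i < N) :
    -(1 / (N : ℝ) * ∑ l ∈ range N, Real.cos ((i : ℤ) * freq N l) * powerSymbol s N (freq N l)) =
      (i : ℝ) ^ (-(1 + s)) + ((N - i : ℕ) : ℝ) ^ (-(1 + s)) := by
  have hN : 0 < N := by omega
  have hNr : (N : ℝ) ≠ 0 := by exact_mod_cast hN.ne'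
  have expand : ∀ l, Real.cos ((i : ℤ) * freq N l) * powerSymbol s N (freq N l) =
      ∑ k ∈ Ico 1 N, (k : ℝ) ^ (-(1 + s)) * (2 * Real.cos ((i : ℤ) * freq N l) -
        Real.cos ((i + k : ℤ) * freq N l) - Real.cos ((i - k : ℤ) * freq N l)) := by
    intro l
    unfold powerSymbol
    rw [mul_sum, mul_sum]
    refine sum_congr rfl fun k _ => ?_
    have e1 : ((i + k : ℤ) : ℝ) * freq N l = (i : ℤ) * freq N l + k * freq N l := by
      push_cast; ring
    have e2 : ((i - k : ℤ) : ℝ) * freq N l = (i : ℤ) * freq N l - k * freq N l := by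
      push_cast; ring
    push_cast at e1 e2 ⊢
    rw [e1, e2, Real.cos_add, Real.cos_sub]
    ring
  have inner : ∀ k ∈ Ico 1 N, ∑ l ∈ range N, (2 * Real.cos ((i : ℤ) * freq N l) -
        Real.cos ((i + k : ℤ) * freq N l) - Real.cos ((i - k : ℤ) * freq N l)) =
      -(N * ((if k = N - i then 1 else 0) + (if k = i then 1 else 0))) := by
    intro k hk
    rw [mem_Ico] at hk
    rw [sum_sub_distrib, sum_sub_distrib, ← mul_sum, sum_cos_mul_freq hN, sum_cos_mul_freq hN,
      sum_cos_mul_freq hN]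
    have h1 : ¬ (N : ℤ) ∣ (i : ℤ) := by
      rw [Int.natCast_dvd_natCast]; exact Nat.not_dvd_of_pos_of_lt hi hiN
    have h2 : (N : ℤ) ∣ (i + k : ℤ) ↔ k = N - i := by
      constructor
      · rintro ⟨t, ht⟩
        have : t = 1 := by nlinarith
        subst this; omega
      · rintro rfl; exact ⟨1, by omega⟩
    have h3 : (N : ℤ) ∣ (i - k : ℤ) ↔ k = i := by
      constructor
      · rintro ⟨t, ht⟩
        have : t = 0 := by nlinarith
        subst this; omega
      · rintro rfl; simp
    rw [if_neg h1]
    simp only [h2, h3]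
    split_ifs <;> ring
  simp_rw [expand]
  rw [sum_comm]
  simp_rw [← mul_sum]
  rw [sum_congr rfl fun k hk => by rw [inner k hk]]
  have split : ∀ k ∈ Ico 1 N, (k : ℝ) ^ (-(1 + s)) *
      (-(N * ((if k = N - i then 1 else 0) + (if k = i then 1 else 0)))) =
      -N * ((if k = N - i then (k : ℝ) ^ (-(1 + s)) else 0) +
        (if k = i then (k : ℝ) ^ (-(1 + s)) else 0)) := by
    intro k _
    split_ifs <;> ring
  rw [sum_congr rfl split, ← mul_sum, sum_add_distrib, sum_ite_eq', sum_ite_eq',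
    if_pos (by rw [mem_Ico]; omega), if_pos (by rw [mem_Ico]; omega)]
  field_simp
  ring

/-- The second difference of m ↦ 1 - cos mξ at i with step k is -2 cos(iξ)(1 - cos kξ). Summed
against `a` it gives -cos(iξ) `cosSymbol a ξ`, which cancels the denominator in the barrier. -/
theorem hasSum_barrier_second_difference {a : ℕ → ℝ} (ha : ∀ k, 0 ≤ a k) (hsum : Summable a)
    (s : ℝ) {N i : ℕ} (hq : ∀ l ∈ Ico 1 N, cosSymbol a (freq N l) ≠ 0) (hi : 1 ≤ i)
    (hiN : i < N) :
    HasSum (fun k : ℕ => a k *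
        (2 * barrier a s N i - barrier a s N (i + k) - barrier a s N (i - k)))
      ((i : ℝ) ^ (-(1 + s)) + ((N - i : ℕ) : ℝ) ^ (-(1 + s))) := by
  rw [← sum_cos_mul_powerSymbol s hi hiN]
  have hterm : ∀ k : ℕ, a k *
      (2 * barrier a s N i - barrier a s N (i + k) - barrier a s N (i - k)) =
      -(1 / (N : ℝ) * ∑ l ∈ range N, 2 * Real.cos ((i : ℤ) * freq N l) *
        (powerSymbol s N (freq N l) / cosSymbol a (freq N l)) *
          (a k * (1 - Real.cos (k * freq N l)))) := by
    intro k
    unfold barrier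
    rw [mul_left_comm 2, ← mul_sub, ← mul_sub, mul_left_comm, ← mul_neg, mul_sum,
      ← sum_sub_distrib, ← sum_sub_distrib, mul_sum, ← sum_neg_distrib]
    congr 1
    refine sum_congr rfl fun l _ => ?_
    have e1 : ((i + k : ℤ) : ℝ) * freq N l = (i : ℤ) * freq N l + k * freq N l := by
      push_cast; ring
    have e2 : ((i - k : ℤ) : ℝ) * freq N l = (i : ℤ) * freq N l - k * freq N l := by
      push_cast; ring
    rw [e1, e2, Real.cos_add, Real.cos_sub]
    ring
  simp_rw [hterm]
  refine HasSum.neg (HasSum.mul_left _ (hasSum_sum fun l hl => ?_))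
  have hs := ((summable_mul_one_sub_cos ha hsum (freq N l)).hasSum).mul_left
    (2 * Real.cos ((i : ℤ) * freq N l) * (powerSymbol s N (freq N l) / cosSymbol a (freq N l)))
  convert hs using 1
  -- At l = 0 the quotient of symbols is 0/0, but `powerSymbol` vanishes there and both sides are 0.
  rcases Nat.eq_zero_or_pos l with rfl | hl0
  · simp [powerSymbol, freq]
  · have hne := hq l (mem_Ico.2 ⟨hl0, mem_range.1 hl⟩)
    have e : ∑' k : ℕ, a k * (1 - Real.cos (k * freq N l)) = cosSymbol a (freq N l) / 2 := by
      unfold cosSymbol; ring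
    rw [e]
    field_simp

/-- The contribution to the operator with jump weights `a` at `i` of the values of `f` outside
the interior `1, …, N - 1`. -/
def exitSum (a : ℕ → ℝ) (f : ℤ → ℝ) (N i : ℕ) : ℝ :=
  ∑' k : ℕ, a k * ((if N ≤ i + k then f (i + k) else 0) + (if i ≤ k then f (i - k) else 0))

theorem summable_exit {a : ℕ → ℝ} (ha : ∀ k, 0 ≤ a k) (hsum : Summable a) {f : ℤ → ℝ}
    {B : ℝ} (hf : ∀ m, |f m| ≤ B) (N i : ℕ) :
    Summable fun k : ℕ =>
      a k * ((if N ≤ i + k then f (i + k) else 0) + (if i ≤ k then f (i - k) else 0)) := by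
  have hB : 0 ≤ B := (abs_nonneg _).trans (hf 0)
  refine Summable.of_norm_bounded (hsum.mul_right (B + B)) fun k => ?_
  rw [norm_mul, Real.norm_of_nonneg (ha k)]
  refine mul_le_mul_of_nonneg_left ((norm_add_le _ _).trans (add_le_add ?_ ?_)) (ha k)
  · split_ifs
    · exact hf _
    · simpa using hB
  · split_ifs
    · exact hf _
    · simpa using hB

/-- Evenness and periodicity fold an exit value to the barrier at k - i or k - (N - i), hence to at
most a multiple of k^s. The terms are then of order k^{-(1+α)+s} = k^{-(2+s)}, whose tails match the
right-hand side of the barrier equation. -/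
theorem exitSum_barrier_le {a : ℕ → ℝ} (ha : ∀ k, 0 ≤ a k) (hsum : Summable a) {α c C s : ℝ}
    (hα : 1 < α) (hα2 : α < 2) (hc : 0 < c)
    (hlow : ∀ k : ℕ, 1 ≤ k → c * (k : ℝ) ^ (-(1 + α)) ≤ a k)
    (hup : ∀ k : ℕ, 1 ≤ k → a k ≤ C * (k : ℝ) ^ (-(1 + α)))
    (hs : s = (α - 1) / 2) :
    ∃ K : ℝ, 0 ≤ K ∧ ∀ N i : ℕ, 1 ≤ i → i < N →
      exitSum a (barrier a s N) N i ≤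
        K * ((i : ℝ) ^ (-(1 + s)) + ((N - i : ℕ) : ℝ) ^ (-(1 + s))) := by
  obtain ⟨D, hD0, hD⟩ := barrier_le ha hsum hα hα2 hc hlow hs
  have hs0 : 0 < s := by linarith
  have hp : 0 < 1 + s := by linarith
  have hC0 : 0 ≤ C := by
    have := (ha 1).trans (hup 1 le_rfl)
    simpa using this
  refine ⟨C * D * ((1 + s + 2) / (1 + s)), by positivity, fun N i hi hiN => ?_⟩
  have hN : 0 < N := by omega
  have bound : ∀ j k : ℕ, 1 ≤ j → j ≤ k → a k * barrier a s N ((k - j : ℕ) : ℤ) ≤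
      C * D * (k : ℝ) ^ (-(1 + (1 + s))) := by
    intro j k hj hjk
    have hk0 : (0 : ℝ) < k := by exact_mod_cast lt_of_lt_of_le hj hjk
    have h1 : barrier a s N ((k - j : ℕ) : ℤ) ≤ D * (k : ℝ) ^ s := by
      refine (hD N (k - j) hN).trans ?_
      gcongr
      exact Nat.sub_le k j
    calc a k * barrier a s N ((k - j : ℕ) : ℤ)
        ≤ (C * (k : ℝ) ^ (-(1 + α))) * (D * (k : ℝ) ^ s) :=
          mul_le_mul (hup k (hj.trans hjk)) h1 (barrier_nonneg ha _ _ _) (by positivity)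
      _ = C * D * ((k : ℝ) ^ (-(1 + α)) * (k : ℝ) ^ s) := by ring
      _ = C * D * (k : ℝ) ^ (-(1 + (1 + s))) := by
          rw [← Real.rpow_add hk0]
          congr 2
          rw [hs]
          ring
  have hterm : ∀ k : ℕ, a k * ((if N ≤ i + k then barrier a s N (i + k) else 0) +
      (if i ≤ k then barrier a s N (i - k) else 0)) ≤
      C * D * ((if N - i ≤ k then (k : ℝ) ^ (-(1 + (1 + s))) else 0) +
        (if i ≤ k then (k : ℝ) ^ (-(1 + (1 + s))) else 0)) := by
    intro k
    rw [mul_add, mul_add]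
    refine add_le_add ?_ ?_
    · by_cases h : N ≤ i + k
      · rw [if_pos h, if_pos (by omega)]
        have e : (i + k : ℤ) = ((k - (N - i) : ℕ) : ℤ) + (1 : ℤ) * N := by omega
        rw [e, barrier_periodic a s hN]
        exact bound (N - i) k (by omega) (by omega)
      · rw [if_neg h, if_neg (by omega)]; simp
    · by_cases h : i ≤ k
      · rw [if_pos h, if_pos h]
        have e : (i - k : ℤ) = -((k - i : ℕ) : ℤ) := by omega
        rw [e, barrier_neg]
        exact bound i k hi h
      · rw [if_neg h, if_neg h]; simp
  obtain ⟨S1, T1⟩ := summable_ite_rpow_and_tsum_le hp (m := N - i) (by omega)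
  obtain ⟨S2, T2⟩ := summable_ite_rpow_and_tsum_le hp hi
  have hS := (S1.add S2).mul_left (C * D)
  have h0 : ∀ k : ℕ, 0 ≤ a k * ((if N ≤ i + k then barrier a s N (i + k) else 0) +
      (if i ≤ k then barrier a s N (i - k) else 0)) := by
    intro k
    refine mul_nonneg (ha k) (add_nonneg ?_ ?_)
    · split_ifs
      · exact barrier_nonneg ha _ _ _
      · exact le_rfl
    · split_ifs
      · exact barrier_nonneg ha _ _ _
      · exact le_rfl
  calc exitSum a (barrier a s N) N i
      ≤ ∑' k : ℕ, C * D * ((if N - i ≤ k then (k : ℝ) ^ (-(1 + (1 + s))) else 0) +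
        (if i ≤ k then (k : ℝ) ^ (-(1 + (1 + s))) else 0)) :=
        Summable.tsum_le_tsum hterm (Summable.of_nonneg_of_le h0 hterm hS) hS
    _ = C * D * (∑' k : ℕ, (if N - i ≤ k then (k : ℝ) ^ (-(1 + (1 + s))) else 0) +
        ∑' k : ℕ, (if i ≤ k then (k : ℝ) ^ (-(1 + (1 + s))) else 0)) := by
        rw [tsum_mul_left, S1.tsum_add S2]
    _ ≤ C * D * ((1 + s + 2) / (1 + s) * ((N - i : ℕ) : ℝ) ^ (-(1 + s)) +
        (1 + s + 2) / (1 + s) * (i : ℝ) ^ (-(1 + s))) := by gcongr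
    _ = _ := by ring

/-- Minimum principle: at an interior zero of a nonnegative function the operator is nonpositive,
whereas its value on the barrier is positive. -/
theorem barrier_pos {a : ℕ → ℝ} (ha : ∀ k, 0 ≤ a k) (hsum : Summable a) (s : ℝ) {N i : ℕ}
    (hq : ∀ l ∈ Ico 1 N, cosSymbol a (freq N l) ≠ 0) (hi : 1 ≤ i) (hiN : i < N) :
    0 < barrier a s N i := by
  refine lt_of_le_of_ne (barrier_nonneg ha s N i) fun h => ?_
  have hS := hasSum_barrier_second_difference ha hsum s hq hi hiN
  rw [← h] at hS
  have hle : (i : ℝ) ^ (-(1 + s)) + ((N - i : ℕ) : ℝ) ^ (-(1 + s)) ≤ 0 :=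
    hasSum_le (fun k => mul_nonpos_of_nonneg_of_nonpos (ha k) (by
      linarith [barrier_nonneg ha s N (i + k), barrier_nonneg ha s N (i - k)])) hS hasSum_zero
  have : (0 : ℝ) < i := by exact_mod_cast hi
  have h1 : (0 : ℝ) < (i : ℝ) ^ (-(1 + s)) := by positivity
  have h2 : (0 : ℝ) ≤ ((N - i : ℕ) : ℝ) ^ (-(1 + s)) := by positivity
  linarith

/-! ### Sine transform and Toeplitz matrices -/

/-- The symmetric Toeplitz matrix of the operator with jump weights `a`. -/
def levyMatrix (a : ℕ → ℝ) (n : ℕ) : Matrix (Fin n) (Fin n) ℝ :=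
  Matrix.of fun i j => (if i = j then 2 * ∑' k, a k else 0) - a (Nat.dist i j)

/-- The matrix which the sine transform diagonalizes with eigenvalues the samples of `q`. -/
def tauMatrix (q : ℝ → ℝ) (n : ℕ) : Matrix (Fin n) (Fin n) ℝ :=
  sineMatrix n * Matrix.diagonal (fun j => q (theta n j)) * sineMatrix n

/-- The value at `m` of the odd `2(n+1)`-periodic extension of the indicator function of `j`. -/
def oddDelta (n : ℕ) (m j : ℤ) : ℝ :=
  (if (2 * (n + 1 : ℤ)) ∣ m - j then 1 else 0) - (if (2 * (n + 1 : ℤ)) ∣ m + j then 1 else 0)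

/-- Both sines are odd about the node n + 1 and vanish at 0 and n + 1, so the sum is half of one
over the full period 2(n+1), where `sum_range_cos` applies. -/
theorem sum_sin_mul_sin (n : ℕ) (m j : ℤ) :
    ∑ l : Fin n, Real.sin (m * theta n l) * Real.sin (j * theta n l) =
      (n + 1 : ℝ) / 2 * oddDelta n m j := by
  have hN : (n + 1 : ℝ) ≠ 0 := by positivity
  set G : ℕ → ℝ := fun l => Real.sin (m * (Real.pi * l / (n + 1))) *
    Real.sin (j * (Real.pi * l / (n + 1))) with hG
  have hfin : ∑ l : Fin n, Real.sin (m * theta n l) * Real.sin (j * theta n l) =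
      ∑ l ∈ range n, G (l + 1) := by
    rw [← Fin.sum_univ_eq_sum_range (fun l => G (l + 1))]
    refine sum_congr rfl fun l _ => ?_
    simp only [hG, theta]
    push_cast
    congr 3 <;> ring
  have hreflect : ∀ l, l ≤ n + 1 → G (n + 1 + l) = G (n + 1 - l) := by
    intro l hl
    have harg : ∀ r : ℤ, Real.sin (r * (Real.pi * ((n + 1 + l : ℕ) : ℝ) / (n + 1))) =
        -Real.sin (r * (Real.pi * ((n + 1 - l : ℕ) : ℝ) / (n + 1))) := by
      intro r
      have : (r : ℝ) * (Real.pi * ((n + 1 + l : ℕ) : ℝ) / (n + 1)) =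
          r * (2 * Real.pi) - r * (Real.pi * ((n + 1 - l : ℕ) : ℝ) / (n + 1)) := by
        rw [Nat.cast_sub hl]; push_cast; field_simp; ring
      rw [this, Real.sin_int_mul_two_pi_sub]
    simp only [hG]
    rw [harg, harg]
    ring
  have hfull : ∑ l ∈ range (2 * (n + 1)), G l = (n + 1 : ℝ) * oddDelta n m j := by
    have hterm : ∀ l : ℕ, G l =
        1 / 2 * (Real.cos ((m - j : ℤ) * (2 * Real.pi * l / (2 * (n + 1) : ℕ))) -
          Real.cos ((m + j : ℤ) * (2 * Real.pi * l / (2 * (n + 1) : ℕ)))) := by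
      intro l
      have e : (2 * Real.pi * l / ((2 * (n + 1) : ℕ) : ℝ)) = Real.pi * l / (n + 1) := by
        push_cast; field_simp
      rw [e]
      push_cast
      rw [sub_mul, add_mul, Real.cos_sub, Real.cos_add]
      simp only [hG]
      ring
    simp_rw [hterm]
    rw [← mul_sum, sum_sub_distrib, sum_range_cos (by omega), sum_range_cos (by omega)]
    unfold oddDelta
    push_cast
    split_ifs <;> ring
  have hsplit : ∑ l ∈ range (2 * (n + 1)), G l = 2 * ∑ l ∈ range n, G (l + 1) := by
    have h0 : G 0 = 0 := by simp [hG]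
    have hn1 : G (n + 1) = 0 := by
      have : (m : ℝ) * (Real.pi * ((n + 1 : ℕ) : ℝ) / (n + 1)) = m * Real.pi := by
        push_cast; field_simp
      simp only [hG]
      rw [this, Real.sin_int_mul_pi, zero_mul]
    have h2 : ∑ l ∈ range (n + 1), G (n + 1 + l) = ∑ l ∈ range (n + 1), G (l + 1) := by
      rw [← sum_range_reflect (fun l => G (l + 1))]
      refine sum_congr rfl fun l hl => ?_
      rw [mem_range] at hl
      rw [hreflect l hl.le]
      congr 1
      omega
    rw [two_mul (n + 1), sum_range_add, h2, sum_range_succ' G n, sum_range_succ _ n, h0, hn1]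
    ring
  rw [hfin]
  linarith

theorem sineMatrix_mul_apply (n : ℕ) (d : Fin n → ℝ) (i j : Fin n) :
    (sineMatrix n * Matrix.diagonal d * sineMatrix n) i j =
      2 / (n + 1) * ∑ l : Fin n, Real.sin (((i : ℕ) + 1 : ℤ) * theta n l) *
        Real.sin (((j : ℕ) + 1 : ℤ) * theta n l) * d l := by
  rw [Matrix.mul_apply, mul_sum]
  refine sum_congr rfl fun l _ => ?_
  rw [Matrix.mul_diagonal]
  simp only [sineMatrix, Matrix.of_apply]
  have h1 : Real.sqrt (2 / ((n : ℝ) + 1)) * Real.sqrt (2 / ((n : ℝ) + 1)) = 2 / (n + 1) :=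
    Real.mul_self_sqrt (by positivity)
  have h2 : ((l : ℕ) + 1 : ℝ) * theta n j = ((j : ℕ) + 1 : ℝ) * theta n l := by
    unfold theta; ring
  rw [h2]
  push_cast
  linear_combination (Real.sin (((i : ℕ) + 1) * theta n l) * Real.sin (((j : ℕ) + 1) * theta n l) *
    d l) * h1

theorem oddDelta_of_mem {n : ℕ} {m j : ℤ} (hm : 1 ≤ m) (hmn : m < n + 1) (hj : 1 ≤ j)
    (hjn : j < n + 1) : oddDelta n m j = if m = j then 1 else 0 := by
  have h1 : 2 * (n + 1 : ℤ) ∣ m - j ↔ m = j := by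
    constructor
    · intro h
      have := Int.eq_zero_of_abs_lt_dvd h (by rw [abs_lt]; constructor <;> omega)
      omega
    · rintro rfl; simp
  have h2 : ¬ 2 * (n + 1 : ℤ) ∣ m + j := by
    intro h
    have := Int.eq_zero_of_abs_lt_dvd h (by rw [abs_lt]; constructor <;> omega)
    omega
  unfold oddDelta
  rw [if_neg h2, sub_zero]
  simp only [h1]

theorem sineMatrix_mul_self (n : ℕ) : sineMatrix n * sineMatrix n = 1 := by
  ext i j
  have h := sineMatrix_mul_apply n (fun _ => 1) i j
  rw [Matrix.diagonal_one, Matrix.mul_one] at h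
  rw [h]
  simp only [mul_one]
  rw [sum_sin_mul_sin, oddDelta_of_mem (by omega) (by omega) (by omega) (by omega),
    Matrix.one_apply]
  have : (n + 1 : ℝ) ≠ 0 := by positivity
  have e : ((i : ℕ) + 1 : ℤ) = (j : ℕ) + 1 ↔ i = j := by rw [Fin.ext_iff]; omega
  simp only [e]
  split_ifs
  · field_simp
  · ring

/-- Sines diagonalize the operator on odd 2(n+1)-periodic sequences, so the τ matrix is the operator
acting on odd periodic extensions. -/
theorem hasSum_tauMatrix_apply {a : ℕ → ℝ} (ha : ∀ k, 0 ≤ a k) (hsum : Summable a) {n : ℕ}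
    (i j : Fin n) :
    HasSum (fun k : ℕ => a k * (2 * oddDelta n (i + 1) (j + 1) - oddDelta n (i + 1 + k) (j + 1) -
      oddDelta n (i + 1 - k) (j + 1))) (tauMatrix (cosSymbol a) n i j) := by
  have hN : (n + 1 : ℝ) ≠ 0 := by positivity
  unfold tauMatrix
  rw [sineMatrix_mul_apply]
  have hdelta : ∀ m r : ℤ, oddDelta n m r =
      2 / (n + 1) * ∑ l : Fin n, Real.sin (m * theta n l) * Real.sin (r * theta n l) := by
    intro m r
    rw [sum_sin_mul_sin]; field_simp
  have hterm : ∀ k : ℕ, a k * (2 * oddDelta n (i + 1) (j + 1) -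
      oddDelta n (i + 1 + k) (j + 1) - oddDelta n (i + 1 - k) (j + 1)) =
      2 / (n + 1) * ∑ l : Fin n, Real.sin (((i : ℕ) + 1 : ℤ) * theta n l) *
        Real.sin (((j : ℕ) + 1 : ℤ) * theta n l) * (2 * (a k * (1 - Real.cos (k * theta n l)))) := by
    intro k
    rw [hdelta, hdelta, hdelta, mul_left_comm 2, ← mul_sub, ← mul_sub, mul_left_comm, mul_sum,
      ← sum_sub_distrib, ← sum_sub_distrib, mul_sum]
    congr 1
    refine sum_congr rfl fun l _ => ?_
    have e1 : (((i : ℕ) + 1 + k : ℤ) : ℝ) * theta n l =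
        (((i : ℕ) + 1 : ℤ) : ℝ) * theta n l + k * theta n l := by push_cast; ring
    have e2 : (((i : ℕ) + 1 - k : ℤ) : ℝ) * theta n l =
        (((i : ℕ) + 1 : ℤ) : ℝ) * theta n l - k * theta n l := by push_cast; ring
    rw [e1, e2, Real.sin_add, Real.sin_sub]
    ring
  simp_rw [hterm]
  refine HasSum.mul_left _ (hasSum_sum fun l _ => HasSum.mul_left _ ?_)
  exact ((summable_mul_one_sub_cos ha hsum _).hasSum).mul_left 2

/-- The same series with extension by zero. On the diagonal k = 0 meets both indicators, which is
harmless because `a 0 = 0`. -/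
theorem hasSum_levyMatrix_apply {a : ℕ → ℝ} (ha0 : a 0 = 0) (hsum : Summable a) {n : ℕ}
    (i j : Fin n) :
    HasSum (fun k : ℕ => a k * (2 * (if (i + 1 : ℤ) = j + 1 then 1 else 0) -
      (if (i + 1 + k : ℤ) = j + 1 then 1 else 0) -
      (if (i + 1 - k : ℤ) = j + 1 then 1 else 0))) (levyMatrix a n i j) := by
  have hdist : HasSum (fun k : ℕ => a k * ((if (i + 1 + k : ℤ) = j + 1 then 1 else 0) +
      (if (i + 1 - k : ℤ) = j + 1 then 1 else 0))) (a (Nat.dist i j)) := by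
    have h := hasSum_single (f := fun k : ℕ => a k *
      ((if (i + 1 + k : ℤ) = j + 1 then 1 else 0) +
      (if (i + 1 - k : ℤ) = j + 1 then (1 : ℝ) else 0))) (Nat.dist i j) (by
        intro k hk
        unfold Nat.dist at hk
        rw [if_neg (by omega), if_neg (by omega)]
        simp)
    convert h using 1
    rcases lt_trichotomy (i : ℕ) j with hij | hij | hij
    · have e : Nat.dist i j = j - i := by unfold Nat.dist; omega
      rw [e, if_pos (by omega), if_neg (by omega)]; simp
    · have e : Nat.dist i j = 0 := by unfold Nat.dist; omega
      rw [e, ha0]; simp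
    · have e : Nat.dist i j = i - j := by unfold Nat.dist; omega
      rw [e, if_neg (by omega), if_pos (by omega)]; simp
  have hdiag : HasSum (fun k : ℕ => a k * (2 * (if (i + 1 : ℤ) = j + 1 then 1 else 0)))
      (if i = j then 2 * ∑' k, a k else 0) := by
    by_cases h : i = j
    · rw [if_pos h, if_pos (by rw [h])]
      simpa only [mul_one, mul_comm _ (2 : ℝ)] using hsum.hasSum.mul_left 2
    · rw [if_neg h, if_neg (by rw [Fin.ext_iff] at h; omega)]
      simp
  have h := hdiag.sub hdist
  simp only [← mul_sub, ← sub_sub] at h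
  exact h

/-- The two extensions agree on 1, …, n. Elsewhere at most one interior point is congruent to ±m
modulo 2(n+1), and `f`, being even and (n+1)-periodic, takes the same value there as at `m`. -/
theorem sum_abs_oddDelta_sub_le {f : ℤ → ℝ} (hf0 : ∀ m, 0 ≤ f m) (hfneg : ∀ m, f (-m) = f m)
    {n : ℕ} (hfper : ∀ m j : ℤ, f (m + j * (n + 1 : ℕ)) = f m) (m : ℤ) :
    ∑ j : Fin n, |(if m = j + 1 then 1 else 0) - oddDelta n m (j + 1)| * f (j + 1) ≤
      if 1 ≤ m ∧ m < n + 1 then 0 else f m := by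
  by_cases hm : 1 ≤ m ∧ m < n + 1
  · rw [if_pos hm]
    refine (sum_eq_zero fun j _ => ?_).le
    rw [oddDelta_of_mem hm.1 hm.2 (by omega) (by omega)]
    simp
  · rw [if_neg hm]
    set P : Fin n → Prop := fun j =>
      2 * (n + 1 : ℤ) ∣ m - (j + 1) ∨ 2 * (n + 1 : ℤ) ∣ m + (j + 1) with hP
    have hzero : ∀ j : Fin n, ¬ P j →
        |(if m = j + 1 then 1 else 0) - oddDelta n m (j + 1)| * f (j + 1) = 0 := by
      intro j hj
      simp only [hP, not_or] at hj
      rw [if_neg (by omega)]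
      unfold oddDelta
      rw [if_neg hj.1, if_neg hj.2]
      simp
    by_cases hex : ∃ j, P j
    · obtain ⟨j, hj⟩ := hex
      have huniq : ∀ l, l ≠ j → ¬ P l := by
        intro l hl hPl
        rw [Ne, Fin.ext_iff] at hl
        have key : 2 * (n + 1 : ℤ) ∣ (l : ℤ) - j ∨ 2 * (n + 1 : ℤ) ∣ (l : ℤ) + j + 2 := by
          rcases hj with h1 | h1 <;> rcases hPl with h2 | h2
          · left; have := dvd_sub h1 h2; ring_nf at this ⊢; exact this
          · right; have := dvd_sub h2 h1; ring_nf at this ⊢; exact this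
          · right; have := dvd_sub h1 h2; ring_nf at this ⊢; exact this
          · left; have := dvd_sub h2 h1; ring_nf at this ⊢; exact this
        rcases key with h | h
        · have := Int.eq_zero_of_abs_lt_dvd h (by rw [abs_lt]; constructor <;> omega)
          omega
        · have := Int.eq_zero_of_abs_lt_dvd h (by rw [abs_lt]; constructor <;> omega)
          omega
      have hval : f (j + 1) = f m := by
        rcases hj with ⟨t, ht⟩ | ⟨t, ht⟩
        · have : m = (j + 1) + (2 * t) * (n + 1 : ℕ) := by push_cast; linarith
          rw [this, hfper]
        · have : m = -(j + 1) + (2 * t) * (n + 1 : ℕ) := by push_cast; linarith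
          rw [this, hfper, hfneg]
      rw [sum_eq_single j (fun l _ hl => hzero l (huniq l hl)) (by simp), hval,
        if_neg (by omega)]
      have habs : |0 - oddDelta n m (j + 1)| ≤ 1 := by
        unfold oddDelta
        split_ifs <;> norm_num
      nlinarith [hf0 m]
    · push Not at hex
      rw [sum_eq_zero fun j _ => hzero j (hex j)]
      exact hf0 m

theorem sum_indicator_mul (f : ℤ → ℝ) (n : ℕ) (m : ℤ) :
    ∑ j : Fin n, (if m = j + 1 then 1 else 0) * f (j + 1) =
      if 1 ≤ m ∧ m < n + 1 then f m else 0 := by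
  by_cases hm : 1 ≤ m ∧ m < n + 1
  · rw [if_pos hm, sum_eq_single (⟨(m - 1).toNat, by omega⟩ : Fin n)]
    · have e : (((m - 1).toNat : ℕ) : ℤ) + 1 = m := by omega
      simp only [e]
      simp
    · intro j _ hj
      rw [Ne, Fin.ext_iff] at hj
      rw [if_neg (by simp only at hj; omega)]
      simp
    · simp
  · rw [if_neg hm]
    refine sum_eq_zero fun j _ => ?_
    rw [if_neg (by omega)]
    simp

/-- `A` has nonpositive off-diagonal entries, and for the positive vector `φ` the vector `A φ` is
positive with `|E| φ ≤ ρ A φ`. -/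
structure DominatedBy {ι : Type*} [Fintype ι] (A E : Matrix ι ι ℝ) (ρ : ℝ) (φ : ι → ℝ) :
    Prop where
  pos : ∀ i, 0 < φ i
  row_pos : ∀ i, 0 < ∑ j, A i j * φ j
  le : ∀ i, ∑ j, |E i j| * φ j ≤ ρ * ∑ j, A i j * φ j
  offDiag : ∀ i j, i ≠ j → A i j ≤ 0

/-- Extension by zero omits the subtracted values outside 1, …, n, so the exit sum is gained on top
of the barrier equation. -/
theorem levyMatrix_mul_barrier {a : ℕ → ℝ} (ha0 : a 0 = 0) (ha : ∀ k, 0 ≤ a k)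
    (hsum : Summable a) (s : ℝ) {n : ℕ}
    (hq : ∀ l ∈ Ico 1 (n + 1), cosSymbol a (freq (n + 1) l) ≠ 0) {B : ℝ}
    (hB : ∀ m, |barrier a s (n + 1) m| ≤ B) (i : Fin n) :
    ∑ j : Fin n, levyMatrix a n i j * barrier a s (n + 1) (j + 1) =
      (((i : ℕ) + 1 : ℕ) : ℝ) ^ (-(1 + s)) + ((n + 1 - ((i : ℕ) + 1) : ℕ) : ℝ) ^ (-(1 + s)) +
        exitSum a (barrier a s (n + 1)) (n + 1) (i + 1) := by
  set f := barrier a s (n + 1) with hf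
  have h1 : HasSum (fun k : ℕ => ∑ j : Fin n, (a k * (2 * (if (i + 1 : ℤ) = j + 1 then 1 else 0) -
      (if (i + 1 + k : ℤ) = j + 1 then 1 else 0) -
      (if (i + 1 - k : ℤ) = j + 1 then 1 else 0))) * f (j + 1))
      (∑ j : Fin n, levyMatrix a n i j * f (j + 1)) :=
    hasSum_sum fun j _ => (hasSum_levyMatrix_apply ha0 hsum i j).mul_right _
  have h2 := (hasSum_barrier_second_difference ha hsum s (i := i + 1) hq (by omega)
    (by omega)).add (summable_exit ha hsum hB (n + 1) (i + 1)).hasSum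
  refine h1.unique (h2.congr_fun fun k => ?_)
  have e : ∀ j : Fin n, (a k * (2 * (if (i + 1 : ℤ) = j + 1 then 1 else 0) -
      (if (i + 1 + k : ℤ) = j + 1 then 1 else 0) -
      (if (i + 1 - k : ℤ) = j + 1 then 1 else 0))) * f (j + 1) =
      a k * (2 * ((if (i + 1 : ℤ) = j + 1 then 1 else 0) * f (j + 1)) -
      (if (i + 1 + k : ℤ) = j + 1 then 1 else 0) * f (j + 1) -
      (if (i + 1 - k : ℤ) = j + 1 then 1 else 0) * f (j + 1)) := fun j => by ring
  simp_rw [e]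
  rw [← mul_sum, sum_sub_distrib, sum_sub_distrib, ← mul_sum, sum_indicator_mul,
    sum_indicator_mul, sum_indicator_mul, ← mul_add]
  congr 1
  push_cast
  rw [if_pos (by omega)]
  have c1 : (1 ≤ (i + 1 + k : ℤ) ∧ (i + 1 + k : ℤ) < n + 1) ↔ ¬ (n + 1 ≤ (i : ℕ) + 1 + k) := by
    omega
  have c2 : (1 ≤ (i + 1 - k : ℤ) ∧ (i + 1 - k : ℤ) < n + 1) ↔ ¬ ((i : ℕ) + 1 ≤ k) := by
    omega
  simp only [c1, c2]
  split_ifs <;> ring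

theorem abs_indicator_sub_oddDelta_le (n : ℕ) (m j : ℤ) :
    |(if m = j then 1 else 0) - oddDelta n m j| ≤ 2 := by
  unfold oddDelta
  split_ifs <;> norm_num

/-- The central terms cancel; what is left is the discrepancy of the two extensions at i ± k, which
is nonzero only outside the interior. -/
theorem sum_abs_tauMatrix_sub_le {a : ℕ → ℝ} (ha0 : a 0 = 0) (ha : ∀ k, 0 ≤ a k)
    (hsum : Summable a) {f : ℤ → ℝ} (hf0 : ∀ m, 0 ≤ f m) (hfneg : ∀ m, f (-m) = f m)
    {n : ℕ} (hfper : ∀ m j : ℤ, f (m + j * (n + 1 : ℕ)) = f m) {B : ℝ} (hB : ∀ m, |f m| ≤ B)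
    (i : Fin n) :
    ∑ j : Fin n, |(tauMatrix (cosSymbol a) n - levyMatrix a n) i j| * f (j + 1) ≤
      exitSum a f (n + 1) (i + 1) := by
  set e : ℤ → Fin n → ℝ := fun m j => (if m = j + 1 then 1 else 0) - oddDelta n m (j + 1) with he
  have hE : ∀ j : Fin n, HasSum (fun k : ℕ => a k * (e (i + 1 + k) j + e (i + 1 - k) j))
      ((tauMatrix (cosSymbol a) n - levyMatrix a n) i j) := by
    intro j
    refine ((hasSum_tauMatrix_apply ha hsum i j).sub
      (hasSum_levyMatrix_apply ha0 hsum i j)).congr_fun fun k => ?_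
    rw [oddDelta_of_mem (m := i + 1) (by omega) (by omega) (by omega) (by omega)]
    simp only [he]
    ring
  have hg : ∀ j : Fin n, Summable fun k : ℕ => a k * (|e (i + 1 + k) j| + |e (i + 1 - k) j|) := by
    intro j
    refine Summable.of_nonneg_of_le (fun k => mul_nonneg (ha k) (by positivity)) (fun k => ?_)
      (hsum.mul_right 4)
    refine mul_le_mul_of_nonneg_left ?_ (ha k)
    have h1 := abs_indicator_sub_oddDelta_le n (i + 1 + k) (j + 1)
    have h2 := abs_indicator_sub_oddDelta_le n (i + 1 - k) (j + 1)
    simp only [he]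
    linarith
  have habs : ∀ j : Fin n, |(tauMatrix (cosSymbol a) n - levyMatrix a n) i j| ≤
      ∑' k : ℕ, a k * (|e (i + 1 + k) j| + |e (i + 1 - k) j|) := by
    intro j
    rw [← (hE j).tsum_eq, ← Real.norm_eq_abs]
    refine tsum_of_norm_bounded (hg j).hasSum fun k => ?_
    rw [norm_mul, Real.norm_of_nonneg (ha k)]
    exact mul_le_mul_of_nonneg_left (norm_add_le _ _) (ha k)
  have hswap : HasSum (fun k : ℕ => ∑ j : Fin n,
      a k * (|e (i + 1 + k) j| + |e (i + 1 - k) j|) * f (j + 1))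
      (∑ j : Fin n, (∑' k : ℕ, a k * (|e (i + 1 + k) j| + |e (i + 1 - k) j|)) * f (j + 1)) :=
    hasSum_sum fun j _ => (hg j).hasSum.mul_right _
  refine (sum_le_sum fun j _ => mul_le_mul_of_nonneg_right (habs j) (hf0 (j + 1))).trans ?_
  refine hasSum_le (fun k => ?_) hswap (summable_exit ha hsum hB (n + 1) (i + 1)).hasSum
  have hsplit : ∑ j : Fin n, a k * (|e (i + 1 + k) j| + |e (i + 1 - k) j|) * f (j + 1) =
      a k * (∑ j : Fin n, |e (i + 1 + k) j| * f (j + 1) +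
        ∑ j : Fin n, |e (i + 1 - k) j| * f (j + 1)) := by
    rw [← sum_add_distrib, mul_sum]
    exact sum_congr rfl fun j _ => by ring
  rw [hsplit]
  refine mul_le_mul_of_nonneg_left (add_le_add ?_ ?_) (ha k)
  · refine (sum_abs_oddDelta_sub_le hf0 hfneg hfper _).trans (le_of_eq ?_)
    push_cast
    have c1 : (1 ≤ (i + 1 + k : ℤ) ∧ (i + 1 + k : ℤ) < n + 1) ↔ ¬ (n + 1 ≤ (i : ℕ) + 1 + k) := by
      omega
    simp only [c1, ite_not]
  · refine (sum_abs_oddDelta_sub_le hf0 hfneg hfper _).trans (le_of_eq ?_)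
    push_cast
    have c2 : (1 ≤ (i + 1 - k : ℤ) ∧ (i + 1 - k : ℤ) < n + 1) ↔ ¬ ((i : ℕ) + 1 ≤ k) := by
      omega
    simp only [c2, ite_not]

theorem exists_dominatedBy {a : ℕ → ℝ} (ha0 : a 0 = 0) (ha : ∀ k, 0 ≤ a k) (hsum : Summable a)
    {α c C : ℝ} (hα : 1 < α) (hα2 : α < 2) (hc : 0 < c)
    (hlow : ∀ k : ℕ, 1 ≤ k → c * (k : ℝ) ^ (-(1 + α)) ≤ a k)
    (hup : ∀ k : ℕ, 1 ≤ k → a k ≤ C * (k : ℝ) ^ (-(1 + α))) :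
    ∃ ρ : ℝ, 0 ≤ ρ ∧ ρ < 1 ∧ ∀ n, ∃ φ : Fin n → ℝ,
      DominatedBy (levyMatrix a n) (tauMatrix (cosSymbol a) n - levyMatrix a n) ρ φ := by
  obtain ⟨K, hK0, hK⟩ := exitSum_barrier_le ha hsum hα hα2 hc hlow hup rfl
  set s := (α - 1) / 2 with hs
  -- With b the right-hand side of the barrier equation and e the exit sum, e ≤ K b gives e ≤
  -- K/(1+K) · (b + e).
  refine ⟨K / (1 + K), by positivity, by rw [div_lt_one (by positivity)]; linarith, fun n => ?_⟩
  have hq : ∀ l ∈ Ico 1 (n + 1), cosSymbol a (freq (n + 1) l) ≠ 0 := fun l hl =>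
    (cosSymbol_freq_pos ha hsum hα hα2 hc hlow hl).ne'
  set f := barrier a s (n + 1) with hf
  have hf0 : ∀ m, 0 ≤ f m := barrier_nonneg ha s (n + 1)
  have hper : ∀ m j : ℤ, f (m + j * (n + 1 : ℕ)) = f m := barrier_periodic a s (by omega)
  -- This crude bound depends on `n`, but it serves only for summability.
  have hB : ∀ m, |f m| ≤ ∑ r ∈ range (n + 1), f r := by
    intro m
    rw [abs_of_nonneg (hf0 m)]
    have e : f m = f ((m % (n + 1 : ℕ)).toNat : ℤ) := by
      rw [Int.toNat_of_nonneg (Int.emod_nonneg _ (by omega)),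
        ← hper (m % (n + 1 : ℕ)) (m / (n + 1 : ℕ)), mul_comm, Int.emod_add_mul_ediv]
    rw [e]
    refine single_le_sum (f := fun r : ℕ => f r) (fun r _ => hf0 r) (mem_range.2 ?_)
    have := Int.emod_lt_of_pos m (show (0 : ℤ) < (n + 1 : ℕ) by omega)
    omega
  have hA := fun i => levyMatrix_mul_barrier ha0 ha hsum s hq hB (i : Fin n)
  have hexit0 : ∀ i : ℕ, 0 ≤ exitSum a f (n + 1) i := by
    intro i
    refine tsum_nonneg fun k => mul_nonneg (ha k) (add_nonneg ?_ ?_)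
    · split_ifs
      · exact hf0 _
      · exact le_rfl
    · split_ifs
      · exact hf0 _
      · exact le_rfl
  refine ⟨fun i => f (i + 1), fun i => ?_, fun i => ?_, fun i => ?_, fun i j hij => ?_⟩
  · have := barrier_pos ha hsum s (i := i + 1) hq (by omega) (by omega)
    exact_mod_cast this
  · rw [hA i]
    have h1 : (0 : ℝ) < (((i : ℕ) + 1 : ℕ) : ℝ) ^ (-(1 + s)) := by positivity
    have h2 : (0 : ℝ) ≤ ((n + 1 - ((i : ℕ) + 1) : ℕ) : ℝ) ^ (-(1 + s)) := by positivity
    linarith [hexit0 (i + 1)]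
  · have hE : ∑ j : Fin n, |(tauMatrix (cosSymbol a) n - levyMatrix a n) i j| * f (j + 1) ≤
        exitSum a f (n + 1) (i + 1) :=
      sum_abs_tauMatrix_sub_le ha0 ha hsum hf0 (barrier_neg a s (n + 1)) hper hB i
    have hk := hK (n + 1) (i + 1) (by omega) (by omega)
    rw [hA i]
    refine hE.trans ?_
    rw [div_mul_eq_mul_div, le_div_iff₀ (by positivity)]
    linarith
  · simp only [levyMatrix, Matrix.of_apply, if_neg hij]
    linarith [ha (Nat.dist i j)]

/-! ### The fractional binomial coefficients -/

theorem g_zero (α : ℝ) : g α 0 = 1 := by simp [g]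

theorem g_succ (α : ℝ) (k : ℕ) : g α (k + 1) = (k - α) / (k + 1) * g α k := by
  unfold g
  rw [prod_range_succ, pow_succ, Nat.factorial_succ]
  have h1 : (k.factorial : ℝ) ≠ 0 := by positivity
  have h2 : (k + 1 : ℝ) ≠ 0 := by positivity
  push_cast
  field_simp
  ring

theorem g_one (α : ℝ) : g α 1 = -α := by
  have := g_succ α 0
  rw [g_zero] at this
  simpa using this

theorem g_two (α : ℝ) : g α 2 = α * (α - 1) / 2 := by
  have := g_succ α 1
  rw [g_one] at this
  rw [this]
  push_cast
  ring

theorem g_pos {α : ℝ} (hα : 1 < α) (hα2 : α < 2) {k : ℕ} (hk : 2 ≤ k) : 0 < g α k := by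
  induction k, hk using Nat.le_induction with
  | base => rw [g_two]; nlinarith
  | succ k hk ih =>
    have : (2 : ℝ) ≤ k := by exact_mod_cast hk
    rw [g_succ]
    have : 0 < k - α := by linarith
    positivity

/-- By Bernoulli, (k - α)/(k + 1) = 1 - (1+α)/(k+1) ≤ (k/(k+1))^{1+α}, so g_k k^{1+α} is
nonincreasing from k = 2 on. -/
theorem g_le {α : ℝ} (hα : 1 < α) (hα2 : α < 2) {k : ℕ} (hk : 2 ≤ k) :
    g α k ≤ g α 2 * 2 ^ (1 + α) * (k : ℝ) ^ (-(1 + α)) := by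
  have h2 := g_pos hα hα2 le_rfl
  induction k, hk using Nat.le_induction with
  | base =>
    rw [mul_assoc]
    push_cast
    rw [← Real.rpow_add two_pos]
    simp
  | succ k hk ih =>
    have hk2 : (2 : ℝ) ≤ k := by exact_mod_cast hk
    have hk0 : (0 : ℝ) < k := by linarith
    have hbern : ((k : ℝ) - α) / (k + 1) ≤ ((k : ℝ) / (k + 1)) ^ (1 + α) := by
      have hs : -1 ≤ -(1 / ((k : ℝ) + 1)) := by
        rw [neg_le_neg_iff, div_le_one (by positivity)]; linarith
      have := one_add_mul_self_le_rpow_one_add hs (p := 1 + α) (by linarith)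
      calc ((k : ℝ) - α) / (k + 1) = 1 + (1 + α) * -(1 / ((k : ℝ) + 1)) := by field_simp; ring
        _ ≤ _ := this
        _ = _ := by congr 1; field_simp; ring
    have hpow : ((k : ℝ) / (k + 1)) ^ (1 + α) * (k : ℝ) ^ (-(1 + α)) =
        ((k + 1 : ℕ) : ℝ) ^ (-(1 + α)) := by
      rw [Real.div_rpow hk0.le (by positivity), Real.rpow_neg hk0.le, Real.rpow_neg (by positivity)]
      have : (0 : ℝ) < (k : ℝ) ^ (1 + α) := by positivity
      push_cast
      field_simp
    rw [g_succ, ← hpow]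
    have hg := (g_pos hα hα2 hk).le
    calc ((k : ℝ) - α) / (k + 1) * g α k
        ≤ ((k : ℝ) / (k + 1)) ^ (1 + α) * g α k := by gcongr
      _ ≤ ((k : ℝ) / (k + 1)) ^ (1 + α) * (g α 2 * 2 ^ (1 + α) * (k : ℝ) ^ (-(1 + α))) := by
          gcongr
      _ = _ := by ring

/-- After the shift k ↦ k - α - 1 Bernoulli works in the other direction: g_k (k - α - 1)^{1+α} is
nondecreasing. The start k = 3 is the first with a positive base, 2 - α. -/
theorem g_ge {α : ℝ} (hα : 1 < α) (hα2 : α < 2) {k : ℕ} (hk : 3 ≤ k) :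
    g α 3 * (2 - α) ^ (1 + α) * (k : ℝ) ^ (-(1 + α)) ≤ g α k := by
  have h3 := g_pos hα hα2 (k := 3) (by norm_num)
  have h2α : 0 < 2 - α := by linarith
  have key : g α 3 * (2 - α) ^ (1 + α) * ((k : ℝ) - α - 1) ^ (-(1 + α)) ≤ g α k := by
    induction k, hk using Nat.le_induction with
    | base =>
      rw [mul_assoc, show ((3 : ℕ) : ℝ) - α - 1 = 2 - α by push_cast; ring,
        ← Real.rpow_add h2α]
      simp
    | succ k hk ih =>
      have hk3 : (3 : ℝ) ≤ k := by exact_mod_cast hk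
      set y : ℝ := k - α with hy
      have hy1 : 1 < y := by linarith
      have hbern : ((y - 1) / y) ^ (1 + α) ≤ y / (y + (1 + α)) := by
        have h1 := one_add_mul_self_le_rpow_one_add (s := 1 / y)
          (by have : 0 < 1 / y := by positivity
              linarith) (p := 1 + α) (by linarith)
        have h4 : (y - 1) / y ≤ (1 + 1 / y)⁻¹ := by
          rw [show (1 + 1 / y)⁻¹ = y / (y + 1) by field_simp, div_le_div_iff₀ (by linarith)
            (by linarith)]
          nlinarith
        calc ((y - 1) / y) ^ (1 + α) ≤ ((1 + 1 / y)⁻¹) ^ (1 + α) := by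
              gcongr
          _ = ((1 + 1 / y) ^ (1 + α))⁻¹ := Real.inv_rpow (by positivity) _
          _ ≤ (1 + (1 + α) * (1 / y))⁻¹ := by gcongr
          _ = y / (y + (1 + α)) := by field_simp
      have hpow : y ^ (-(1 + α)) = ((y - 1) / y) ^ (1 + α) * (y - 1) ^ (-(1 + α)) := by
        rw [Real.div_rpow (by linarith) (by linarith), Real.rpow_neg (by linarith),
          Real.rpow_neg (by linarith)]
        have : 0 < (y - 1) ^ (1 + α) := Real.rpow_pos_of_pos (by linarith) _
        field_simp
      have e1 : ((k + 1 : ℕ) : ℝ) - α - 1 = y := by push_cast; rw [hy]; ring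
      have e2 : ((k : ℝ) - α) / (k + 1) = y / (y + (1 + α)) := by rw [hy]; congr 1; ring
      have h5 : 0 ≤ (y - 1) ^ (-(1 + α)) := Real.rpow_nonneg (by linarith) _
      have hG : 0 ≤ g α 3 * (2 - α) ^ (1 + α) := by positivity
      rw [e1, g_succ α k, e2, hpow]
      calc g α 3 * (2 - α) ^ (1 + α) * (((y - 1) / y) ^ (1 + α) * (y - 1) ^ (-(1 + α)))
          ≤ g α 3 * (2 - α) ^ (1 + α) * (y / (y + (1 + α)) * (y - 1) ^ (-(1 + α))) := by
            gcongr
        _ = y / (y + (1 + α)) * (g α 3 * (2 - α) ^ (1 + α) * (y - 1) ^ (-(1 + α))) := by ring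
        _ ≤ y / (y + (1 + α)) * g α k := by gcongr
  have hk3 : (3 : ℝ) ≤ k := by exact_mod_cast hk
  refine le_trans ?_ key
  gcongr 1
  exact Real.rpow_le_rpow_of_nonpos (by linarith) (by linarith) (by linarith)

theorem summable_g {α : ℝ} (hα : 1 < α) (hα2 : α < 2) : Summable (g α) := by
  rw [← summable_nat_add_iff 2]
  have hs : Summable fun k : ℕ => g α 2 * 2 ^ (1 + α) * ((k : ℝ) ^ (-(1 + α))) :=
    (Real.summable_nat_rpow.2 (by linarith)).mul_left _
  rw [← summable_nat_add_iff 2] at hs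
  exact Summable.of_nonneg_of_le (fun k => (g_pos hα hα2 (by omega)).le)
    (fun k => g_le hα hα2 (by omega)) hs

/-- The jump weights of the symmetric operator with matrices `S α n + (S α n)ᵀ`. -/
def jump (α : ℝ) (k : ℕ) : ℝ :=
  w α (k + 1) + (if k = 1 then w α 0 else 0) - (if k = 0 then w α 1 else 0)

theorem jump_zero (α : ℝ) : jump α 0 = 0 := by simp [jump]

/-- `w α 2` alone is negative for α near 1; symmetrization adds `w α 0` from the other off-diagonal,
and the sum is positive. -/
theorem jump_one (α : ℝ) : jump α 1 = α * (α - 1) * (α + 2) / 4 := by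
  simp only [jump, w, g_zero, g_one, Nat.reduceAdd, g_two]
  norm_num
  ring

theorem jump_of_two_le (α : ℝ) {k : ℕ} (hk : 2 ≤ k) :
    jump α k = α / 2 * g α (k + 1) + (2 - α) / 2 * g α k := by
  simp only [jump, w]
  rw [if_neg (by omega), if_neg (by omega)]
  ring

theorem exists_le_jump {α : ℝ} (hα : 1 < α) (hα2 : α < 2) :
    ∃ c : ℝ, 0 < c ∧ ∀ k : ℕ, 1 ≤ k → c * (k : ℝ) ^ (-(1 + α)) ≤ jump α k := by
  have h3 := g_pos hα hα2 (k := 3) (by norm_num)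
  have h2α : 0 < 2 - α := by linarith
  have hα1 : 0 < α - 1 := by linarith
  set c1 := α / 2 * (g α 3 * (2 - α) ^ (1 + α)) with hc1
  have hc1p : 0 < c1 := by positivity
  have hj1 : 0 < jump α 1 := by rw [jump_one]; positivity
  have hmain : ∀ k : ℕ, 2 ≤ k → c1 * ((k + 1 : ℕ) : ℝ) ^ (-(1 + α)) ≤ jump α k := by
    intro k hk
    rw [jump_of_two_le α hk]
    have h1 := g_ge hα hα2 (k := k + 1) (by omega)
    have h2 : 0 ≤ (2 - α) / 2 * g α k := mul_nonneg (by linarith) (g_pos hα hα2 hk).le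
    have h4 : α / 2 * (g α 3 * (2 - α) ^ (1 + α) * ((k + 1 : ℕ) : ℝ) ^ (-(1 + α))) ≤
        α / 2 * g α (k + 1) := by gcongr
    rw [hc1]
    linarith
  refine ⟨min (c1 * 2 ^ (-(1 + α))) (jump α 1), by positivity, fun k hk => ?_⟩
  rcases Nat.lt_or_ge k 2 with h | h
  · have : k = 1 := by omega
    subst this
    simp
  · have hk0 : (0 : ℝ) < k := by exact_mod_cast hk
    have hk1 : (1 : ℝ) ≤ k := by exact_mod_cast hk
    calc min (c1 * 2 ^ (-(1 + α))) (jump α 1) * (k : ℝ) ^ (-(1 + α))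
        ≤ c1 * 2 ^ (-(1 + α)) * (k : ℝ) ^ (-(1 + α)) := by gcongr; exact min_le_left _ _
      _ = c1 * (2 * k) ^ (-(1 + α)) := by rw [mul_assoc, Real.mul_rpow two_pos.le hk0.le]
      _ ≤ c1 * ((k + 1 : ℕ) : ℝ) ^ (-(1 + α)) := by
          gcongr 1
          refine Real.rpow_le_rpow_of_nonpos (by positivity) ?_ (by linarith)
          push_cast; linarith
      _ ≤ jump α k := hmain k h

theorem exists_jump_le {α : ℝ} (hα : 1 < α) (hα2 : α < 2) :
    ∃ C : ℝ, ∀ k : ℕ, 1 ≤ k → jump α k ≤ C * (k : ℝ) ^ (-(1 + α)) := by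
  have h2 := g_pos hα hα2 (k := 2) le_rfl
  set M := g α 2 * 2 ^ (1 + α) with hM
  have hMp : 0 < M := by positivity
  refine ⟨max M (jump α 1), fun k hk => ?_⟩
  rcases Nat.lt_or_ge k 2 with h | h
  · have : k = 1 := by omega
    subst this
    simp
  · have hk0 : (0 : ℝ) < k := by exact_mod_cast hk
    have e1 := g_le hα hα2 h
    have e2 := g_le hα hα2 (k := k + 1) (by omega)
    have e3 : ((k + 1 : ℕ) : ℝ) ^ (-(1 + α)) ≤ (k : ℝ) ^ (-(1 + α)) := by
      refine Real.rpow_le_rpow_of_nonpos hk0 ?_ (by linarith)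
      push_cast; linarith
    have e4 : g α (k + 1) ≤ M * (k : ℝ) ^ (-(1 + α)) := e2.trans (by gcongr)
    rw [jump_of_two_le α h]
    calc α / 2 * g α (k + 1) + (2 - α) / 2 * g α k
        ≤ α / 2 * (M * (k : ℝ) ^ (-(1 + α))) + (2 - α) / 2 * (M * (k : ℝ) ^ (-(1 + α))) := by
          have : 0 ≤ (2 - α) / 2 := by linarith
          gcongr
      _ = M * (k : ℝ) ^ (-(1 + α)) := by ring
      _ ≤ _ := by gcongr; exact le_max_left _ _

theorem jump_nonneg {α : ℝ} (hα : 1 < α) (hα2 : α < 2) (k : ℕ) : 0 ≤ jump α k := by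
  rcases Nat.eq_zero_or_pos k with rfl | hk
  · rw [jump_zero]
  · obtain ⟨c, hc, h⟩ := exists_le_jump hα hα2
    exact le_trans (by positivity) (h k hk)

theorem summable_jump {α : ℝ} (hα : 1 < α) (hα2 : α < 2) : Summable (jump α) := by
  obtain ⟨C, hC⟩ := exists_jump_le hα hα2
  have hs : Summable fun k : ℕ => C * ((k : ℝ) ^ (-(1 + α))) :=
    (Real.summable_nat_rpow.2 (by linarith)).mul_left _
  rw [← summable_nat_add_iff 1] at hs ⊢
  exact Summable.of_nonneg_of_le (fun k => jump_nonneg hα hα2 _) (fun k => hC _ (by omega)) hs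

/-! ### The symbol -/

theorem choose_eq_g (α : ℝ) (k : ℕ) : Ring.choose (α : ℂ) k = (-1) ^ k * (g α k : ℂ) := by
  induction k with
  | zero => simp [g_zero]
  | succ k ih =>
    have h := Ring.choose_smul_choose (α : ℂ) (Nat.le_succ k)
    simp only [Nat.succ_eq_add_one, Nat.choose_succ_self_right, nsmul_eq_mul,
      Nat.add_sub_cancel_left, Ring.choose_one_right] at h
    rw [ih] at h
    have hk : ((k : ℂ) + 1) ≠ 0 := by exact_mod_cast Nat.succ_ne_zero k
    rw [g_succ, pow_succ]
    push_cast at h ⊢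
    field_simp
    linear_combination h

theorem hasSum_g_mul_pow (α : ℝ) {z : ℂ} (hz : ‖z‖ < 1) :
    HasSum (fun k : ℕ => (g α k : ℂ) * z ^ k) ((1 - z) ^ (α : ℂ)) := by
  have h := (Complex.one_add_cpow_hasFPowerSeriesOnBall_zero (a := (α : ℂ))).hasSum (y := -z)
    (by simpa [Metric.mem_eball, edist_zero_right, enorm_neg, ← ofReal_norm] using hz)
  rw [zero_add] at h
  rw [← sub_eq_add_neg] at h
  refine h.congr_fun fun k => ?_
  rw [binomialSeries_apply, choose_eq_g]
  simp only [List.ofFn_const, List.prod_replicate, smul_eq_mul]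
  rw [neg_pow z]
  have : ((-1 : ℂ) ^ k) * (-1) ^ k = 1 := by rw [← mul_pow]; simp
  linear_combination (-(g α k : ℂ) * z ^ k) * this

/-- Abel's limit theorem carries the binomial series to the unit circle. The power is continuous up
to z = 1 because Re(1 - z) ≥ 0 and the exponent is positive. -/
theorem hasSum_g_mul_exp {α : ℝ} (hα : 1 < α) (hα2 : α < 2) {z : ℂ} (hz : ‖z‖ = 1) :
    HasSum (fun k : ℕ => (g α k : ℂ) * z ^ k) ((1 - z) ^ (α : ℂ)) := by
  have hsum : Summable fun k : ℕ => (g α k : ℂ) * z ^ k := by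
    refine Summable.of_norm ?_
    simpa [hz] using (summable_g hα hα2).abs
  have habel := Complex.tendsto_tsum_powerSeries_nhdsWithin_lt hsum.hasSum.tendsto_sum_nat
  rw [Filter.tendsto_map'_iff] at habel
  have hlim : Filter.Tendsto (fun x : ℝ => (1 - z * x) ^ (α : ℂ)) (nhdsWithin 1 (Set.Iio 1))
      (nhds ((1 - z) ^ (α : ℂ))) := by
    have hc : ContinuousAt (fun x : ℂ × ℂ => x.1 ^ x.2) (1 - z, (α : ℂ)) := by
      refine Complex.continuousAt_cpow_of_re_pos (Or.inl ?_) ?_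
      · have := Complex.re_le_norm z
        simp only [Complex.sub_re, Complex.one_re]
        linarith
      · simp only [Complex.ofReal_re]; linarith
    have hin : Filter.Tendsto (fun x : ℝ => ((1 - z * x, (α : ℂ)) : ℂ × ℂ))
        (nhdsWithin 1 (Set.Iio 1)) (nhds (1 - z, (α : ℂ))) := by
      have : Continuous fun x : ℝ => ((1 - z * x, (α : ℂ)) : ℂ × ℂ) := by fun_prop
      have h := this.tendsto 1
      simp only [Complex.ofReal_one, mul_one] at h
      exact h.mono_left nhdsWithin_le_nhds
    exact Filter.Tendsto.comp hc hin
  have heq : (fun x : ℝ => (1 - z * x) ^ (α : ℂ)) =ᶠ[nhdsWithin 1 (Set.Iio 1)]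
      ((fun y : ℂ => ∑' k : ℕ, (g α k : ℂ) * z ^ k * y ^ k) ∘ Complex.ofReal) := by
    have h0 : ∀ᶠ x : ℝ in nhdsWithin 1 (Set.Iio 1), 0 < x :=
      nhdsWithin_le_nhds (lt_mem_nhds one_pos)
    filter_upwards [h0, self_mem_nhdsWithin] with x hx0 hx1
    have hx1' : x < 1 := hx1
    have hn : ‖z * x‖ < 1 := by
      rw [norm_mul, hz, one_mul, Complex.norm_real, Real.norm_of_nonneg hx0.le]; exact hx1'
    rw [← (hasSum_g_mul_pow α hn).tsum_eq]
    simp only [Function.comp, mul_pow, mul_assoc]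
  exact tendsto_nhds_unique habel (hlim.congr' heq) ▸ hsum.hasSum

/-- The factor z⁻¹ in the symbol shifts the binomial series by one index. The term lost at the
start, (α/2) cos θ, is w_0 cos θ, which `jump` restores at k = 1. -/
theorem hasSum_jump_mul_cos {α : ℝ} (hα : 1 < α) (hα2 : α < 2) (θ : ℝ) :
    HasSum (fun k : ℕ => jump α k * Real.cos (k * θ)) (-(wSymbol α θ).re - w α 1) := by
  set z : ℂ := Complex.exp (Complex.I * θ) with hz
  have hznorm : ‖z‖ = 1 := by rw [hz, mul_comm]; exact Complex.norm_exp_ofReal_mul_I θ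
  have hz0 : z ≠ 0 := Complex.exp_ne_zero _
  have hinv : Complex.exp (-(Complex.I * θ)) = z⁻¹ := Complex.exp_neg _
  have hpow : ∀ k : ℕ, (z ^ k).re = Real.cos (k * θ) := by
    intro k
    rw [hz, ← Complex.exp_nat_mul,
      show (k : ℂ) * (Complex.I * θ) = ((k * θ : ℝ) : ℂ) * Complex.I by push_cast; ring,
      Complex.exp_ofReal_mul_I_re]
  have hinvre : (z⁻¹).re = Real.cos θ := by
    rw [← hinv, show -(Complex.I * θ) = ((-θ : ℝ) : ℂ) * Complex.I by push_cast; ring,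
      Complex.exp_ofReal_mul_I_re, Real.cos_neg]
  have hG := hasSum_g_mul_exp hα hα2 hznorm
  have h1 : HasSum (fun k : ℕ => (2 - α) / 2 * (g α k * Real.cos (k * θ)))
      ((2 - α) / 2 * ((1 - z) ^ (α : ℂ)).re) := by
    have := Complex.hasSum_re hG
    simp only [Complex.re_ofReal_mul, hpow] at this
    exact this.mul_left _
  have h2 : HasSum (fun k : ℕ => α / 2 * (g α (k + 1) * Real.cos (k * θ)))
      (α / 2 * (z⁻¹ * (1 - z) ^ (α : ℂ)).re - α / 2 * Real.cos θ) := by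
    have hs := hG.mul_left z⁻¹
    rw [← hasSum_nat_add_iff' 1] at hs
    have hs' := (Complex.hasSum_re hs).mul_left (α / 2)
    simp only [range_one, sum_singleton, g_zero, Complex.ofReal_one, pow_zero, mul_one,
      Complex.sub_re, hinvre, mul_sub] at hs'
    refine hs'.congr_fun fun k => ?_
    rw [pow_succ', mul_left_comm (z⁻¹), inv_mul_cancel_left₀ hz0, Complex.re_ofReal_mul, hpow]
  have h3 : HasSum (fun k : ℕ => w α (k + 1) * Real.cos (k * θ))
      (-(wSymbol α θ).re - α / 2 * Real.cos θ) := by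
    have hval : -(wSymbol α θ).re - α / 2 * Real.cos θ =
        α / 2 * (z⁻¹ * (1 - z) ^ (α : ℂ)).re - α / 2 * Real.cos θ +
          (2 - α) / 2 * ((1 - z) ^ (α : ℂ)).re := by
      have e : wSymbol α θ = -(((2 - α) / 2 : ℝ) * (1 - z) ^ (α : ℂ) +
          ((α / 2 : ℝ) : ℂ) * (z⁻¹ * (1 - z) ^ (α : ℂ))) := by
        unfold wSymbol
        rw [hinv, ← hz]
        push_cast
        ring
      rw [e, Complex.neg_re, Complex.add_re, Complex.re_ofReal_mul, Complex.re_ofReal_mul]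
      ring
    rw [hval]
    refine (h2.add h1).congr_fun fun k => ?_
    simp only [w]
    ring
  have h4 : HasSum (fun k : ℕ => if k = 1 then w α 0 * Real.cos θ else 0) (w α 0 * Real.cos θ) :=
    hasSum_ite_eq 1 _
  have h5 : HasSum (fun k : ℕ => if k = 0 then w α 1 else 0) (w α 1) := hasSum_ite_eq 0 _
  have hval : -(wSymbol α θ).re - w α 1 =
      -(wSymbol α θ).re - α / 2 * Real.cos θ + w α 0 * Real.cos θ - w α 1 := by
    simp only [w, g_zero]
    ring
  rw [hval]
  refine ((h3.add h4).sub h5).congr_fun fun k => ?_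
  unfold jump
  rcases k with _ | _ | k
  · simp
  · simp; ring
  · simp

theorem tsum_jump {α : ℝ} (hα : 1 < α) (hα2 : α < 2) : 2 * ∑' k, jump α k = -2 * w α 1 := by
  have h := hasSum_jump_mul_cos hα hα2 0
  have h0 : wSymbol α 0 = 0 := by
    have : (α : ℂ) ≠ 0 := by exact_mod_cast (by linarith : α ≠ 0)
    simp [wSymbol, Complex.zero_cpow this]
  simp only [mul_zero, Real.cos_zero, mul_one, h0, Complex.zero_re, neg_zero, zero_sub] at h
  rw [h.tsum_eq]
  ring

theorem qSymbol_eq_cosSymbol {α : ℝ} (hα : 1 < α) (hα2 : α < 2) :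
    qSymbol α = cosSymbol (jump α) := by
  ext θ
  have h := hasSum_jump_mul_cos hα hα2 θ
  have hs := (summable_jump hα hα2).hasSum.sub h
  simp only [← mul_one_sub] at hs
  unfold cosSymbol qSymbol
  rw [hs.tsum_eq, mul_sub, tsum_jump hα hα2, Complex.add_re, Complex.conj_re]
  ring

theorem S_add_transpose {α : ℝ} (hα : 1 < α) (hα2 : α < 2) (n : ℕ) :
    S α n + (S α n).transpose = levyMatrix (jump α) n := by
  ext i j
  simp only [Matrix.add_apply, Matrix.transpose_apply, S, levyMatrix, Matrix.of_apply,
    tsum_jump hα hα2, Fin.ext_iff]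
  have sub : ∀ i j : ℕ, i < j → ((if j ≤ i + 1 then -w α (i + 1 - j) else 0) +
      if i ≤ j + 1 then -w α (j + 1 - i) else 0) = -jump α (j - i) := by
    intro i j hij
    obtain ⟨k, rfl⟩ := Nat.exists_eq_add_of_lt hij
    rw [show i + k + 1 + 1 - i = k + 1 + 1 by omega, show i + k + 1 - i = k + 1 by omega,
      if_pos (by omega : i ≤ i + k + 1 + 1)]
    unfold jump
    rcases k with _ | k
    · simp
    · rw [if_neg (by omega), if_neg (by omega), if_neg (by omega)]; ring
  rcases lt_trichotomy (i : ℕ) j with h | h | h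
  · rw [sub i j h, if_neg (by omega), show Nat.dist i j = j - i by unfold Nat.dist; omega]
    ring
  · rw [h]
    simp [Nat.dist_self, jump_zero]
    ring
  · rw [add_comm, sub j i h, if_neg (by omega),
      show Nat.dist i j = i - j by unfold Nat.dist; omega]
    ring

theorem exists_dominatedBy_S {α : ℝ} (hα : 1 < α) (hα2 : α < 2) :
    ∃ ρ : ℝ, 0 ≤ ρ ∧ ρ < 1 ∧ ∀ n, ∃ φ : Fin n → ℝ,
      DominatedBy (S α n + (S α n).transpose)
        (tauMatrix (qSymbol α) n - (S α n + (S α n).transpose)) ρ φ := by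
  obtain ⟨c, hc, hlow⟩ := exists_le_jump hα hα2
  obtain ⟨C, hup⟩ := exists_jump_le hα hα2
  simp_rw [S_add_transpose hα hα2, qSymbol_eq_cosSymbol hα hα2]
  exact exists_dominatedBy (jump_zero α) (jump_nonneg hα hα2) (summable_jump hα hα2) hα hα2 hc
    hlow hup

/-! ### Weighted diagonal dominance -/

/-- Take i maximizing |v_i|/φ_i, so that |v_j/v_i| ≤ φ_j/φ_i. Nonpositive off-diagonal entries give
Re X ≥ (A φ)_i/φ_i, while |Y| ≤ (|E| φ)_i/φ_i. -/
theorem DominatedBy.exists_ratio {ι : Type*} [Fintype ι] {A E : Matrix ι ι ℝ} {ρ : ℝ}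
    {φ : ι → ℝ} (h : DominatedBy A E ρ φ) (hρ : 0 ≤ ρ) {v : ι → ℂ} (hv : v ≠ 0) :
    ∃ i, ∃ X Y : ℂ, v i ≠ 0 ∧ ∑ j, (A i j : ℂ) * v j = X * v i ∧
      ∑ j, (E i j : ℂ) * v j = Y * v i ∧ 0 < X.re ∧ ‖Y‖ ≤ ρ * X.re := by
  classical
  obtain ⟨i₀, hi₀⟩ := Function.ne_iff.1 hv
  obtain ⟨i, -, hi⟩ := exists_max_image univ (fun i => ‖v i‖ / φ i) ⟨i₀, mem_univ _⟩
  have hφ := h.pos i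
  have hvi : v i ≠ 0 := by
    intro h0
    have h1 := hi i₀ (mem_univ _)
    rw [h0, norm_zero, zero_div] at h1
    have h2 : 0 < ‖v i₀‖ / φ i₀ := div_pos (norm_pos_iff.2 hi₀) (h.pos i₀)
    linarith
  have hratio : ∀ j, ‖v j / v i‖ ≤ φ j / φ i := by
    intro j
    have h1 := hi j (mem_univ _)
    rw [norm_div, div_le_div_iff₀ (norm_pos_iff.2 hvi) hφ]
    rw [div_le_div_iff₀ (h.pos j) hφ] at h1
    linarith
  have hre : (∑ j, A i j * φ j) / φ i ≤ (∑ j, (A i j : ℂ) * (v j / v i)).re := by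
    rw [Complex.re_sum, sum_div]
    refine sum_le_sum fun j _ => ?_
    rw [Complex.re_ofReal_mul, mul_div_assoc]
    by_cases hij : i = j
    · subst hij
      rw [div_self hvi, div_self hφ.ne', Complex.one_re]
    · have h1 := (Complex.re_le_norm (v j / v i)).trans (hratio j)
      exact mul_le_mul_of_nonpos_left h1 (h.offDiag i j hij)
  have hY : ‖∑ j, (E i j : ℂ) * (v j / v i)‖ ≤ ρ * ((∑ j, A i j * φ j) / φ i) := by
    calc ‖∑ j, (E i j : ℂ) * (v j / v i)‖ ≤ ∑ j, ‖(E i j : ℂ) * (v j / v i)‖ := norm_sum_le _ _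
      _ ≤ ∑ j, |E i j| * (φ j / φ i) := by
          refine sum_le_sum fun j _ => ?_
          rw [norm_mul, Complex.norm_real, Real.norm_eq_abs]
          exact mul_le_mul_of_nonneg_left (hratio j) (abs_nonneg _)
      _ = (∑ j, |E i j| * φ j) / φ i := by
          rw [sum_div]; exact sum_congr rfl fun j _ => by ring
      _ ≤ (ρ * ∑ j, A i j * φ j) / φ i := by gcongr; exact h.le i
      _ = _ := by ring
  refine ⟨i, ∑ j, (A i j : ℂ) * (v j / v i), ∑ j, (E i j : ℂ) * (v j / v i), hvi, ?_, ?_,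
    lt_of_lt_of_le (div_pos (h.row_pos i) hφ) hre, hY.trans (by gcongr)⟩
  · rw [sum_mul]; exact sum_congr rfl fun j _ => by field_simp
  · rw [sum_mul]; exact sum_congr rfl fun j _ => by field_simp

theorem DominatedBy.mono {ι : Type*} [Fintype ι] {A E : Matrix ι ι ℝ} {ρ ρ' : ℝ}
    {φ : ι → ℝ} (h : DominatedBy A E ρ φ) (hρ : ρ ≤ ρ') : DominatedBy A E ρ' φ :=
  ⟨h.pos, h.row_pos, fun i => (h.le i).trans
    (mul_le_mul_of_nonneg_right hρ (h.row_pos i).le), h.offDiag⟩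

/-- On the product vector each row sum separates into ψ (A φ) + t φ (B ψ), so the two inequalities
add, provided they share the same `ρ`. -/
theorem DominatedBy.kronecker {ι κ : Type*} [Fintype ι] [Fintype κ] [DecidableEq ι]
    [DecidableEq κ] {A E : Matrix ι ι ℝ} {B F : Matrix κ κ ℝ} {ρ t : ℝ} {φ : ι → ℝ} {ψ : κ → ℝ}
    (hA : DominatedBy A E ρ φ) (hB : DominatedBy B F ρ ψ) (ht : 0 < t) :
    DominatedBy ((1 : Matrix κ κ ℝ) ⊗ₖ A + t • (B ⊗ₖ (1 : Matrix ι ι ℝ)))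
      ((1 : Matrix κ κ ℝ) ⊗ₖ E + t • (F ⊗ₖ (1 : Matrix ι ι ℝ))) ρ
      (fun p => ψ p.1 * φ p.2) := by
  have hsum : ∀ (P : Matrix ι ι ℝ) (Q : Matrix κ κ ℝ) (p : κ × ι),
      ∑ q : κ × ι, ((1 : Matrix κ κ ℝ) p.1 q.1 * P p.2 q.2 +
        t * (Q p.1 q.1 * (1 : Matrix ι ι ℝ) p.2 q.2)) * (ψ q.1 * φ q.2) =
      ψ p.1 * ∑ j, P p.2 j * φ j + t * (φ p.2 * ∑ j, Q p.1 j * ψ j) := by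
    intro P Q p
    rw [Fintype.sum_prod_type]
    simp only [add_mul, sum_add_distrib]
    congr 1
    · rw [sum_eq_single p.1 (fun j _ hj => by simp [Matrix.one_apply_ne hj.symm]) (by simp), mul_sum]
      refine sum_congr rfl fun j _ => ?_
      rw [Matrix.one_apply_eq]; ring
    · rw [mul_sum, mul_sum]
      refine sum_congr rfl fun j _ => ?_
      rw [sum_eq_single p.2 (fun l _ hl => by simp [Matrix.one_apply_ne hl.symm]) (by simp),
        Matrix.one_apply_eq]
      ring
  refine ⟨fun p => mul_pos (hB.pos _) (hA.pos _), fun p => ?_, fun p => ?_, fun p q hpq => ?_⟩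
  · have h := hsum A B p
    simp only [Matrix.add_apply, Matrix.smul_apply, Matrix.kroneckerMap_apply, smul_eq_mul]
    rw [h]
    have h1 := mul_pos (hB.pos p.1) (hA.row_pos p.2)
    have h2 := mul_pos ht (mul_pos (hA.pos p.2) (hB.row_pos p.1))
    linarith
  · have h := hsum A B p
    have hE := hsum (fun i j => |E i j|) (fun i j => |F i j|) p
    simp only [Matrix.add_apply, Matrix.smul_apply, Matrix.kroneckerMap_apply, smul_eq_mul]
    rw [h]
    have hle : ∑ q : κ × ι, |(1 : Matrix κ κ ℝ) p.1 q.1 * E p.2 q.2 +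
        t * (F p.1 q.1 * (1 : Matrix ι ι ℝ) p.2 q.2)| * (ψ q.1 * φ q.2) ≤
        ∑ q : κ × ι, ((1 : Matrix κ κ ℝ) p.1 q.1 * |E p.2 q.2| +
        t * (|F p.1 q.1| * (1 : Matrix ι ι ℝ) p.2 q.2)) * (ψ q.1 * φ q.2) := by
      refine sum_le_sum fun q _ => mul_le_mul_of_nonneg_right ?_
        (mul_pos (hB.pos _) (hA.pos _)).le
      refine (abs_add_le _ _).trans (le_of_eq ?_)
      have h1 : ∀ i j, |(1 : Matrix κ κ ℝ) i j| = (1 : Matrix κ κ ℝ) i j := fun i j => by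
        rw [Matrix.one_apply]; split_ifs <;> simp
      have h2 : ∀ i j, |(1 : Matrix ι ι ℝ) i j| = (1 : Matrix ι ι ℝ) i j := fun i j => by
        rw [Matrix.one_apply]; split_ifs <;> simp
      rw [abs_mul, abs_mul, abs_mul, h1, h2, abs_of_pos ht]
    refine hle.trans (hE.le.trans ?_)
    have h1 := mul_le_mul_of_nonneg_left (hA.le p.2) (hB.pos p.1).le
    have h2 := mul_le_mul_of_nonneg_left (mul_le_mul_of_nonneg_left (hB.le p.1) (hA.pos p.2).le)
      ht.le
    linarith
  · simp only [Matrix.add_apply, Matrix.smul_apply, Matrix.kroneckerMap_apply, smul_eq_mul]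
    by_cases h1 : p.1 = q.1
    · have h2 : p.2 ≠ q.2 := fun h => hpq (Prod.ext h1 h)
      rw [h1, Matrix.one_apply_eq, Matrix.one_apply_ne h2]
      linarith [hA.offDiag _ _ h2]
    · rw [Matrix.one_apply_ne h1]
      have := hB.offDiag _ _ h1
      by_cases h2 : p.2 = q.2
      · rw [h2, Matrix.one_apply_eq]; nlinarith
      · rw [Matrix.one_apply_ne h2]; simp

/-! ### Bounds for a scalar quotient -/

/-- As Re X > 0, |ε + d X| is at least d |X| and at least ε + d Re X; the perturbation d Y removes
at most ρ d Re X. -/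
theorem le_norm_add_smul {ρ ε d : ℝ} (hρ : 0 ≤ ρ) (hρ1 : ρ < 1) (hε : 0 < ε) (hd : 0 < d)
    {X Y : ℂ} (hX : 0 < X.re) (hY : ‖Y‖ ≤ ρ * X.re) :
    (1 - ρ) * (d * ‖X‖) ≤ ‖(ε + d * X + d * Y : ℂ)‖ ∧
      (1 - ρ) * ε ≤ ‖(ε + d * X + d * Y : ℂ)‖ := by
  have hXn := Complex.re_le_norm X
  have hYn : ‖(d * Y : ℂ)‖ ≤ d * (ρ * X.re) := by
    rw [norm_mul, Complex.norm_real, Real.norm_of_nonneg hd.le]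
    gcongr
  have htri : ‖(ε + d * X : ℂ)‖ - ‖(d * Y : ℂ)‖ ≤ ‖(ε + d * X + d * Y : ℂ)‖ := by
    have := norm_sub_le (ε + d * X + d * Y : ℂ) (d * Y)
    rw [add_sub_cancel_right] at this
    linarith
  have h1 : d * ‖X‖ ≤ ‖(ε + d * X : ℂ)‖ := by
    refine le_of_sq_le_sq ?_ (norm_nonneg _)
    rw [mul_pow, Complex.sq_norm, Complex.sq_norm, Complex.normSq_apply, Complex.normSq_apply]
    simp only [Complex.add_re, Complex.add_im, Complex.ofReal_re, Complex.ofReal_im,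
      Complex.re_ofReal_mul, Complex.im_ofReal_mul]
    nlinarith [mul_pos (mul_pos hε hd) hX]
  have h2 : ε + d * X.re ≤ ‖(ε + d * X : ℂ)‖ := by
    have := Complex.re_le_norm (ε + d * X : ℂ)
    simpa using this
  have h3 : d * (ρ * X.re) ≤ d * (ρ * ‖X‖) := by gcongr
  constructor
  · linarith
  · nlinarith [mul_pos hd hX]

theorem norm_quotient_le {μ ν ρ : ℝ} (hμ : 0 < μ) (hρ : 0 ≤ ρ) (hρ1 : ρ < 1)
    {ε d D : ℝ} (hε : 0 < ε) (hd : d ∈ Set.Icc μ ν) (hD : D ∈ Set.Icc μ ν) {X Y z : ℂ}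
    (hX : 0 < X.re) (hY : ‖Y‖ ≤ ρ * X.re) (hz : ε + D * X = z * (ε + d * X + d * Y)) :
    ‖z‖ ≤ (1 + ν / μ) / (1 - ρ) := by
  have hd0 : 0 < d := hμ.trans_le hd.1
  have hD0 : 0 < D := hμ.trans_le hD.1
  have hρ' : 0 < 1 - ρ := by linarith
  obtain ⟨h1, h2⟩ := le_norm_add_smul hρ hρ1 hε hd0 hX hY
  set Z : ℂ := ε + d * X + d * Y with hZ
  have hZ0 : 0 < ‖Z‖ := lt_of_lt_of_le (by positivity) h2
  have hnum : ‖z‖ * ‖Z‖ ≤ ε + D * ‖X‖ := by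
    rw [← norm_mul, ← hz]
    refine (norm_add_le _ _).trans (le_of_eq ?_)
    rw [norm_mul, Complex.norm_real, Complex.norm_real, Real.norm_of_nonneg hε.le,
      Real.norm_of_nonneg hD0.le]
  have hDd : D ≤ ν / μ * d := by
    rw [div_mul_eq_mul_div, le_div_iff₀ hμ]
    exact mul_le_mul hD.2 hd.1 hμ.le (hD0.le.trans hD.2)
  have hν : 0 ≤ ν / μ := div_nonneg (hD0.le.trans hD.2) hμ.le
  rw [le_div_iff₀ hρ']
  refine le_of_mul_le_mul_right ?_ hZ0
  calc ‖z‖ * (1 - ρ) * ‖Z‖ = (1 - ρ) * (‖z‖ * ‖Z‖) := by ring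
    _ ≤ (1 - ρ) * (ε + D * ‖X‖) := by gcongr
    _ ≤ (1 - ρ) * (ε + ν / μ * d * ‖X‖) := by gcongr
    _ = (1 - ρ) * ε + ν / μ * ((1 - ρ) * (d * ‖X‖)) := by ring
    _ ≤ ‖Z‖ + ν / μ * ‖Z‖ := by gcongr
    _ = (1 + ν / μ) * ‖Z‖ := by ring

/-- Re z |Z|² = Re((ε + D X) conj Z). Without Y this is ε² + ε (D + d) Re X + D d |X|²; the Y term
costs at most a fraction ρ of ε d Re X and of D d |X|². -/
theorem le_re_quotient {μ ν ρ : ℝ} (hμ : 0 < μ) (hρ : 0 ≤ ρ) (hρ1 : ρ < 1)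
    {ε d D : ℝ} (hε : 0 < ε) (hd : d ∈ Set.Icc μ ν) (hD : D ∈ Set.Icc μ ν) {X Y z : ℂ}
    (hX : 0 < X.re) (hY : ‖Y‖ ≤ ρ * X.re) (hz : ε + D * X = z * (ε + d * X + d * Y)) :
    (1 - ρ) * μ ^ 2 / (8 * ν ^ 2) ≤ z.re := by
  have hd0 : 0 < d := hμ.trans_le hd.1
  have hD0 : 0 < D := hμ.trans_le hD.1
  have hν0 : 0 < ν := hD0.trans_le hD.2
  have hρ' : 0 < 1 - ρ := by linarith
  have hXn := Complex.re_le_norm X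
  have hX0 : 0 < ‖X‖ := hX.trans_le hXn
  have hZ2 := (le_norm_add_smul hρ hρ1 hε hd0 hX hY).2
  set Z : ℂ := ε + d * X + d * Y with hZ
  have hZ0 : 0 < ‖Z‖ := lt_of_lt_of_le (by positivity) hZ2
  have hYX : ‖Y‖ ≤ ‖X‖ := hY.trans (by nlinarith)
  have hZle : ‖Z‖ ≤ ε + 2 * (ν * ‖X‖) := by
    have h1 : ‖(ε + d * X + d * Y : ℂ)‖ ≤ ‖(ε : ℂ)‖ + ‖(d * X : ℂ)‖ + ‖(d * Y : ℂ)‖ :=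
      norm_add₃_le
    rw [norm_mul, norm_mul, Complex.norm_real, Complex.norm_real, Real.norm_of_nonneg hε.le,
      Real.norm_of_nonneg hd0.le] at h1
    have h2 : d * ‖X‖ ≤ ν * ‖X‖ := by gcongr; exact hd.2
    have h3 : d * ‖Y‖ ≤ ν * ‖X‖ := by gcongr; exact hd.2
    linarith
  have hid : z.re * ‖Z‖ ^ 2 = ((ε + D * X) * (starRingEnd ℂ) Z).re := by
    rw [hz, mul_assoc, Complex.mul_conj, Complex.sq_norm, mul_comm z, Complex.re_ofReal_mul,
      mul_comm]
  have hcross : -((ε + D * ‖X‖) * (d * (ρ * X.re))) ≤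
      ((ε + D * X) * (starRingEnd ℂ) (d * Y)).re := by
    have h1 := (Complex.abs_re_le_norm ((ε + D * X) * (starRingEnd ℂ) (d * Y)))
    rw [norm_mul, RCLike.norm_conj, norm_mul, Complex.norm_real, Real.norm_of_nonneg hd0.le] at h1
    have h2 : ‖(ε + D * X : ℂ)‖ ≤ ε + D * ‖X‖ := by
      refine (norm_add_le _ _).trans (le_of_eq ?_)
      rw [norm_mul, Complex.norm_real, Complex.norm_real, Real.norm_of_nonneg hε.le,
        Real.norm_of_nonneg hD0.le]
    have h3 : ‖(ε + D * X : ℂ)‖ * (d * ‖Y‖) ≤ (ε + D * ‖X‖) * (d * (ρ * X.re)) := by gcongr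
    exact (abs_le.1 (h1.trans h3)).1
  have hmain : ((ε + D * X) * (starRingEnd ℂ) (ε + d * X : ℂ)).re =
      ε ^ 2 + ε * (D + d) * X.re + D * d * ‖X‖ ^ 2 := by
    rw [Complex.sq_norm, Complex.normSq_apply]
    simp only [map_add, map_mul, Complex.conj_ofReal, Complex.mul_re, Complex.add_re,
      Complex.add_im, Complex.ofReal_re, Complex.ofReal_im, Complex.mul_im, Complex.conj_re,
      Complex.conj_im]
    ring
  have hlow : (1 - ρ) * (ε ^ 2 + μ ^ 2 * ‖X‖ ^ 2) ≤ z.re * ‖Z‖ ^ 2 := by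
    rw [hid, hZ, map_add, mul_add (ε + D * X : ℂ), Complex.add_re, hmain]
    have h1 : D * d * ‖X‖ * (ρ * X.re) ≤ D * d * ‖X‖ * (ρ * ‖X‖) := by gcongr
    have h2 : 0 ≤ ε * D * X.re := by positivity
    have h3 : 0 ≤ (1 - ρ) * (ε * d * X.re) := by positivity
    have h4 : (1 - ρ) * (μ ^ 2 * ‖X‖ ^ 2) ≤ (1 - ρ) * (D * d * ‖X‖ ^ 2) := by
      gcongr
      rw [sq]
      exact mul_le_mul hD.1 hd.1 hμ.le hD0.le
    have h5 : 0 ≤ ρ * ε ^ 2 := by positivity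
    linarith
  -- Source of the 8: |Y| ≤ |X| gives |Z| ≤ ε + 2ν|X|.
  have hsq : ‖Z‖ ^ 2 ≤ 2 * ε ^ 2 + 8 * (ν ^ 2 * ‖X‖ ^ 2) := by
    have h1 : ‖Z‖ ^ 2 ≤ (ε + 2 * (ν * ‖X‖)) ^ 2 := by gcongr
    nlinarith [sq_nonneg (ε - 2 * (ν * ‖X‖))]
  refine le_of_mul_le_mul_right ?_ (pow_pos hZ0 2)
  refine le_trans ?_ hlow
  have hμν : μ ^ 2 ≤ ν ^ 2 := by
    have := hd.1.trans hd.2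
    gcongr
  calc (1 - ρ) * μ ^ 2 / (8 * ν ^ 2) * ‖Z‖ ^ 2
      ≤ (1 - ρ) * μ ^ 2 / (8 * ν ^ 2) * (2 * ε ^ 2 + 8 * (ν ^ 2 * ‖X‖ ^ 2)) := by gcongr
    _ = (1 - ρ) * (μ ^ 2 / ν ^ 2 * (ε ^ 2 / 4) + μ ^ 2 * ‖X‖ ^ 2) := by field_simp; ring
    _ ≤ (1 - ρ) * (1 * (ε ^ 2 / 4) + μ ^ 2 * ‖X‖ ^ 2) := by
        gcongr
        rw [div_le_one (by positivity)]
        exact hμν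
    _ ≤ (1 - ρ) * (ε ^ 2 + μ ^ 2 * ‖X‖ ^ 2) := by
        gcongr
        nlinarith [sq_nonneg ε]

theorem add_smul_ne_zero {ρ ε d : ℝ} (hρ1 : ρ < 1) (hε : 0 < ε) (hd : 0 < d) {X Y : ℂ}
    (hX : 0 < X.re) (hY : ‖Y‖ ≤ ρ * X.re) : (ε + d * X + d * Y : ℂ) ≠ 0 := by
  intro h
  have h1 := congrArg Complex.re h
  simp only [Complex.add_re, Complex.ofReal_re, Complex.re_ofReal_mul, Complex.zero_re] at h1
  have h2 := (Complex.abs_re_le_norm Y).trans hY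
  have h3 := (abs_le.1 h2).1
  nlinarith [mul_pos hd hX]

/-! ### The preconditioned matrices -/

theorem coeffMatrix_eq {α β L₁ R₁ L₂ R₂ ht : ℝ} {dp dm ep em : ℝ → ℝ → ℝ → ℝ} {n₁ n₂ : ℕ}
    {t : ℝ} (h : ∀ p : Fin n₂ × Fin n₁,
      dm (gridPoint L₁ R₁ n₁ p.2) (gridPoint L₂ R₂ n₂ p.1) t =
          dp (gridPoint L₁ R₁ n₁ p.2) (gridPoint L₂ R₂ n₂ p.1) t ∧
        ep (gridPoint L₁ R₁ n₁ p.2) (gridPoint L₂ R₂ n₂ p.1) t =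
          dp (gridPoint L₁ R₁ n₁ p.2) (gridPoint L₂ R₂ n₂ p.1) t ∧
        em (gridPoint L₁ R₁ n₁ p.2) (gridPoint L₂ R₂ n₂ p.1) t =
          dp (gridPoint L₁ R₁ n₁ p.2) (gridPoint L₂ R₂ n₂ p.1) t) :
    coeffMatrix α β L₁ R₁ L₂ R₂ ht dp dm ep em n₁ n₂ t =
      (1 / meshRatio α (step L₁ R₁ n₁) ht) • (1 : Matrix (Fin n₂ × Fin n₁) (Fin n₂ × Fin n₁) ℝ) +
        coeffDiag dp L₁ R₁ L₂ R₂ n₁ n₂ t *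
          ((1 : Matrix (Fin n₂) (Fin n₂) ℝ) ⊗ₖ (S α n₁ + (S α n₁).transpose) +
            (meshRatio β (step L₂ R₂ n₂) ht / meshRatio α (step L₁ R₁ n₁) ht) •
              ((S β n₂ + (S β n₂).transpose) ⊗ₖ (1 : Matrix (Fin n₁) (Fin n₁) ℝ))) := by
  have h1 : coeffDiag dm L₁ R₁ L₂ R₂ n₁ n₂ t = coeffDiag dp L₁ R₁ L₂ R₂ n₁ n₂ t := by
    unfold coeffDiag; congr 1; ext p; exact (h p).1
  have h2 : coeffDiag ep L₁ R₁ L₂ R₂ n₁ n₂ t = coeffDiag dp L₁ R₁ L₂ R₂ n₁ n₂ t := by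
    unfold coeffDiag; congr 1; ext p; exact (h p).2.1
  have h3 : coeffDiag em L₁ R₁ L₂ R₂ n₁ n₂ t = coeffDiag dp L₁ R₁ L₂ R₂ n₁ n₂ t := by
    unfold coeffDiag; congr 1; ext p; exact (h p).2.2
  unfold coeffMatrix
  simp only [h1, h2, h3, Matrix.kronecker_add, Matrix.add_kronecker, Matrix.mul_add,
    Matrix.mul_smul, smul_add]
  abel

/-- The sine matrix is an involution, so conjugation preserves the identity factors and acts on each
direction separately. -/
theorem tauPreconditioner_eq (α β L₁ R₁ L₂ R₂ ht d : ℝ) (n₁ n₂ : ℕ) :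
    tauPreconditioner α β L₁ R₁ L₂ R₂ ht d d n₁ n₂ =
      (1 / meshRatio α (step L₁ R₁ n₁) ht) • (1 : Matrix (Fin n₂ × Fin n₁) (Fin n₂ × Fin n₁) ℝ) +
        d • ((1 : Matrix (Fin n₂) (Fin n₂) ℝ) ⊗ₖ tauMatrix (qSymbol α) n₁ +
          (meshRatio β (step L₂ R₂ n₂) ht / meshRatio α (step L₁ R₁ n₁) ht) •
            (tauMatrix (qSymbol β) n₂ ⊗ₖ (1 : Matrix (Fin n₁) (Fin n₁) ℝ))) := by
  set r := meshRatio α (step L₁ R₁ n₁) ht with hr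
  set s := meshRatio β (step L₂ R₂ n₂) ht with hs
  have hF : FHat α β L₁ R₁ L₂ R₂ ht d d n₁ n₂ =
      (1 / r) • ((1 : Matrix (Fin n₂) (Fin n₂) ℝ) ⊗ₖ (1 : Matrix (Fin n₁) (Fin n₁) ℝ)) +
        d • ((1 : Matrix (Fin n₂) (Fin n₂) ℝ) ⊗ₖ
            Matrix.diagonal (fun j => qSymbol α (theta n₁ j)) +
          (s / r) • (Matrix.diagonal (fun j => qSymbol β (theta n₂ j)) ⊗ₖ
            (1 : Matrix (Fin n₁) (Fin n₁) ℝ))) := by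
    rw [← Matrix.diagonal_one, ← Matrix.diagonal_one, Matrix.diagonal_kronecker_diagonal,
      Matrix.diagonal_kronecker_diagonal, Matrix.diagonal_kronecker_diagonal]
    simp only [← Matrix.diagonal_smul, Matrix.diagonal_add]
    unfold FHat
    refine congrArg Matrix.diagonal (funext fun p => ?_)
    simp only [← hr, ← hs, Pi.smul_apply, smul_eq_mul]
    ring
  unfold tauPreconditioner tauMatrix
  rw [hF]
  simp only [Matrix.mul_add, Matrix.add_mul, Matrix.mul_smul, Matrix.smul_mul,
    ← Matrix.mul_kronecker_mul, Matrix.mul_one, sineMatrix_mul_self, Matrix.one_kronecker_one]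

theorem gridPoint_mem {L R : ℝ} (h : L < R) (n : ℕ) (i : Fin n) :
    gridPoint L R n i ∈ Set.Ioo L R := by
  have hi : ((i : ℕ) + 1 : ℝ) < n + 1 := by
    have : (i : ℕ) < n := i.2
    have : ((i : ℕ) : ℝ) < n := by exact_mod_cast this
    linarith
  have hstep : 0 < step L R n := div_pos (by linarith) (by positivity)
  have hfull : ((n : ℝ) + 1) * step L R n = R - L := by unfold step; field_simp
  unfold gridPoint
  constructor
  · have : 0 < ((i : ℕ) + 1 : ℝ) * step L R n := by positivity
    linarith
  · nlinarith

theorem meshRatio_pos (γ : ℝ) {L R ht : ℝ} (h : L < R) (hht : 0 < ht) (n : ℕ) :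
    0 < meshRatio γ (step L R n) ht := by
  have hstep : 0 < step L R n := div_pos (by linarith) (by positivity)
  unfold meshRatio
  positivity

theorem spectrum_bounds {ι : Type*} [Fintype ι] [DecidableEq ι] {H E : Matrix ι ι ℝ} {ρ : ℝ}
    {φ : ι → ℝ} (h : DominatedBy H E ρ φ) (hρ : 0 ≤ ρ) (hρ1 : ρ < 1) {μ ν ε d : ℝ} (hμ : 0 < μ)
    (hε : 0 < ε) (hd : d ∈ Set.Icc μ ν) {D : ι → ℝ}
    (hD : ∀ i, D i ∈ Set.Icc μ ν) :
    IsUnit (ε • (1 : Matrix ι ι ℝ) + d • (H + E)) ∧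
      ∀ z ∈ spectrum ℂ (((ε • (1 : Matrix ι ι ℝ) + d • (H + E))⁻¹ *
        (ε • (1 : Matrix ι ι ℝ) + Matrix.diagonal D * H)).map (algebraMap ℝ ℂ)),
        (1 - ρ) * μ ^ 2 / (8 * ν ^ 2) ≤ z.re ∧ ‖z‖ ≤ (1 + ν / μ) / (1 - ρ) := by
  set P := ε • (1 : Matrix ι ι ℝ) + d • (H + E) with hP
  set M := ε • (1 : Matrix ι ι ℝ) + Matrix.diagonal D * H with hM
  have hPv : ∀ (v : ι → ℂ) (i : ι), (P.map (algebraMap ℝ ℂ)).mulVec v i =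
      ε * v i + d * (∑ j, (H i j : ℂ) * v j + ∑ j, (E i j : ℂ) * v j) := by
    intro v i
    simp only [Matrix.mulVec, dotProduct, Matrix.map_apply, hP, Matrix.add_apply,
      Matrix.smul_apply, smul_eq_mul, Complex.coe_algebraMap]
    push_cast
    simp only [add_mul, mul_add, sum_add_distrib, mul_sum, mul_assoc]
    congr 1
    rw [sum_eq_single i (fun j _ hj => by simp [Matrix.one_apply_ne hj.symm]) (by simp)]
    simp
  have hMv : ∀ (v : ι → ℂ) (i : ι), (M.map (algebraMap ℝ ℂ)).mulVec v i =
      ε * v i + D i * ∑ j, (H i j : ℂ) * v j := by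
    intro v i
    simp only [Matrix.mulVec, dotProduct, Matrix.map_apply, hM, Matrix.add_apply,
      Matrix.smul_apply, smul_eq_mul, Complex.coe_algebraMap, Matrix.diagonal_mul]
    push_cast
    simp only [add_mul, sum_add_distrib, mul_sum, mul_assoc]
    congr 1
    rw [sum_eq_single i (fun j _ hj => by simp [Matrix.one_apply_ne hj.symm]) (by simp)]
    simp
  -- A kernel vector of `P` would force ε + d X + d Y = 0 in the distinguished row.
  have hunit : IsUnit P := by
    rw [Matrix.isUnit_iff_isUnit_det, isUnit_iff_ne_zero]
    intro hdet
    have hdetC : (P.map (algebraMap ℝ ℂ)).det = 0 := by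
      have := RingHom.map_det (algebraMap ℝ ℂ) P
      rw [hdet, map_zero] at this
      exact this.symm
    obtain ⟨v, hv, hPv0⟩ := Matrix.exists_mulVec_eq_zero_iff.2 hdetC
    obtain ⟨i, X, Y, hvi, hX, hY, hXre, hYn⟩ := h.exists_ratio hρ hv
    have h0 := hPv v i
    rw [hPv0, hX, hY, Pi.zero_apply] at h0
    have h1 : (ε + d * X + d * Y : ℂ) * v i = 0 := by linear_combination -h0
    exact (mul_ne_zero (add_smul_ne_zero hρ1 hε (hμ.trans_le hd.1) hXre hYn) hvi) h1
  refine ⟨hunit, fun z hz => ?_⟩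
  have hPinv : P * P⁻¹ = 1 := Matrix.mul_nonsing_inv P ((Matrix.isUnit_iff_isUnit_det P).1 hunit)
  have hmul : P.map (algebraMap ℝ ℂ) * (P⁻¹ * M).map (algebraMap ℝ ℂ) =
      M.map (algebraMap ℝ ℂ) := by
    rw [← Matrix.map_mul, ← Matrix.mul_assoc, hPinv, Matrix.one_mul]
  set T := (P⁻¹ * M).map (algebraMap ℝ ℂ) with hT
  rw [spectrum.mem_iff, Matrix.isUnit_iff_isUnit_det, isUnit_iff_ne_zero, not_not] at hz
  obtain ⟨v, hv, hTv⟩ := Matrix.exists_mulVec_eq_zero_iff.2 hz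
  have heig : T.mulVec v = z • v := by
    rw [Matrix.sub_mulVec, Algebra.algebraMap_eq_smul_one, Matrix.smul_mulVec,
      Matrix.one_mulVec, sub_eq_zero] at hTv
    exact hTv.symm
  have hMP : (M.map (algebraMap ℝ ℂ)).mulVec v = z • (P.map (algebraMap ℝ ℂ)).mulVec v := by
    rw [← hmul, ← Matrix.mulVec_mulVec, heig, Matrix.mulVec_smul]
  obtain ⟨i, X, Y, hvi, hX, hY, hXre, hYn⟩ := h.exists_ratio hρ hv
  have h0 := congrFun hMP i
  rw [Pi.smul_apply, hMv, hPv, hX, hY, smul_eq_mul] at h0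
  have hq : (ε + D i * X : ℂ) = z * (ε + d * X + d * Y) :=
    mul_right_cancel₀ hvi (by linear_combination h0)
  exact ⟨le_re_quotient hμ hρ hρ1 hε hd (hD i) hXre hYn hq,
    norm_quotient_le hμ hρ hρ1 hε hd (hD i) hXre hYn hq⟩

end FracDiff

end

/-! ### Assembly of the two space directions. -/

theorem mainTheorem7 (α β μ ν : ℝ) (hα₁ : 1 < α) (hα₂ : α < 2) (hβ₁ : 1 < β) (hβ₂ : β < 2)
    (hμ : 0 < μ) (hμν : μ ≤ ν) :
    ∃ c C : ℝ, 0 < c ∧ 0 < C ∧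
      ∀ (L₁ R₁ L₂ R₂ T : ℝ) (dp dm ep em : ℝ → ℝ → ℝ → ℝ),
        L₁ < R₁ → L₂ < R₂ →
        (∀ x ∈ Set.Ioo L₁ R₁, ∀ y ∈ Set.Ioo L₂ R₂, ∀ t ∈ Set.Icc 0 T,
          μ ≤ dp x y t ∧ dp x y t ≤ ν ∧
            dm x y t = dp x y t ∧ ep x y t = dp x y t ∧ em x y t = dp x y t) →
        ∀ (n₁ n₂ m : ℕ) (ht d : ℝ), 0 < ht → (m : ℝ) * ht ≤ T → d ∈ Set.Icc μ ν →
          IsUnit (FracDiff.tauPreconditioner α β L₁ R₁ L₂ R₂ ht d d n₁ n₂) ∧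
          ∀ z ∈ spectrum ℂ
              (((FracDiff.tauPreconditioner α β L₁ R₁ L₂ R₂ ht d d n₁ n₂)⁻¹ *
                FracDiff.coeffMatrix α β L₁ R₁ L₂ R₂ ht dp dm ep em n₁ n₂ ((m : ℝ) * ht)).map
                  (algebraMap ℝ ℂ)),
            c ≤ z.re ∧ ‖z‖ ≤ C := by
  obtain ⟨ρ₁, hρ₁0, hρ₁1, h₁⟩ := FracDiff.exists_dominatedBy_S hα₁ hα₂
  obtain ⟨ρ₂, hρ₂0, hρ₂1, h₂⟩ := FracDiff.exists_dominatedBy_S hβ₁ hβ₂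
  set ρ := max ρ₁ ρ₂ with hρ
  have hρ0 : 0 ≤ ρ := le_max_of_le_left hρ₁0
  have hρ1 : ρ < 1 := max_lt hρ₁1 hρ₂1
  have hν : 0 < ν := hμ.trans_le hμν
  have hρ' : 0 < 1 - ρ := by linarith
  refine ⟨(1 - ρ) * μ ^ 2 / (8 * ν ^ 2), (1 + ν / μ) / (1 - ρ), by positivity, by positivity, ?_⟩
  intro L₁ R₁ L₂ R₂ T dp dm ep em hLR₁ hLR₂ hcoef n₁ n₂ m ht d hht hmT hd
  have hgrid := fun p : Fin n₂ × Fin n₁ => hcoef _ (FracDiff.gridPoint_mem hLR₁ n₁ p.2) _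
    (FracDiff.gridPoint_mem hLR₂ n₂ p.1) ((m : ℝ) * ht) ⟨by positivity, hmT⟩
  have hr := FracDiff.meshRatio_pos α hLR₁ hht n₁
  have hs := FracDiff.meshRatio_pos β hLR₂ hht n₂
  obtain ⟨φ, hφ⟩ := h₁ n₁
  obtain ⟨ψ, hψ⟩ := h₂ n₂
  have hdom := (hφ.mono (le_max_left ρ₁ ρ₂)).kronecker (hψ.mono (le_max_right ρ₁ ρ₂))
    (div_pos hs hr)
  have key := FracDiff.spectrum_bounds hdom hρ0 hρ1 hμ (one_div_pos.2 hr) hd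
    (D := fun p => dp (FracDiff.gridPoint L₁ R₁ n₁ p.2) (FracDiff.gridPoint L₂ R₂ n₂ p.1) (m * ht))
    (fun p => ⟨(hgrid p).1, (hgrid p).2.1⟩)
  rw [FracDiff.tauPreconditioner_eq, FracDiff.coeffMatrix_eq fun p => (hgrid p).2.2]
  have hsum : ∀ t : ℝ, ((1 : Matrix (Fin n₂) (Fin n₂) ℝ) ⊗ₖ
        (FracDiff.S α n₁ + (FracDiff.S α n₁).transpose) +
      t • ((FracDiff.S β n₂ + (FracDiff.S β n₂).transpose) ⊗ₖ
        (1 : Matrix (Fin n₁) (Fin n₁) ℝ))) +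
      ((1 : Matrix (Fin n₂) (Fin n₂) ℝ) ⊗ₖ (FracDiff.tauMatrix (FracDiff.qSymbol α) n₁ -
        (FracDiff.S α n₁ + (FracDiff.S α n₁).transpose)) +
      t • ((FracDiff.tauMatrix (FracDiff.qSymbol β) n₂ -
        (FracDiff.S β n₂ + (FracDiff.S β n₂).transpose)) ⊗ₖ
        (1 : Matrix (Fin n₁) (Fin n₁) ℝ))) =
      (1 : Matrix (Fin n₂) (Fin n₂) ℝ) ⊗ₖ FracDiff.tauMatrix (FracDiff.qSymbol α) n₁ +
      t • (FracDiff.tauMatrix (FracDiff.qSymbol β) n₂ ⊗ₖ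
        (1 : Matrix (Fin n₁) (Fin n₁) ℝ)) := by
    intro t
    ext p q
    simp only [Matrix.add_apply, Matrix.sub_apply, Matrix.smul_apply, Matrix.kroneckerMap_apply,
      smul_eq_mul]
    ring
  rw [hsum] at key
  exact key
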